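/- For integers $k,n\ge 0$ let Ackermann's functions $A_k:\mathbb N\to\mathbb N$ be defined by $A_0(n)=n+2$ for $n \ge 0$, $A_1(0)=0$, $A_k(0)=1$ for $k\ge 2$, and $A_{k+1}(n+1)=A_k(A_{k+1}(n))$ for $k,n\ge 0$. For $f,g:\mathbb N\to\mathbb N$ write $f\preceq g$ when there is an integer $C>0$ such that $f(n)\le C\,g(Cn+C)+Cn+C$ for all $n \in \mathbb N$. For $k\ge 1$ let $$G_k=\langle\, a_1,\dots,a_k,t \mid t^{-1}a_1t=a_1,\ t^{-1}a_it=a_ia_{i-1}\ (1<i\le k)\,\rangle$$ and let $H_k=\langle a_1t,\dots,a_kt\rangle\le G_k$. For a finite generating set $S$ of $G_k$ and a finite generating set $T$ of $H_k$, with word metrics $d_S$ and $d_T$, the distortion function of $H_k$ in $G_k$ is $$\mathrm{Dist}^{G_k}_{H_k}(n)=\max\{\, d_T(1,h) \mid h\in H_k,\ d_S(1,h)\le n \,\}.$$ Then for all $k\ge 1$, and for every choice of $S$ and $T$, $\ \mathrm{Dist}^{G_k}_{H_k}\preceq A_k$. -/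

import Mathlib

namespace Hydra

/-- Ackermann's functions `A_k : ℕ → ℕ`. -/
def A : ℕ → ℕ → ℕ
  | 0, n => n + 2
  | 1, 0 => 0
  | _ + 2, 0 => 1
  | k + 1, n + 1 => A k (A (k + 1) n)

/-- The preorder `f ≼ g` comparing growth rates of functions `ℕ → ℕ`. -/
def Preceq (f g : ℕ → ℕ) : Prop :=
  ∃ C : ℕ, 0 < C ∧ ∀ n : ℕ, f n ≤ C * g (C * n + C) + C * n + C

/-- `IsWord S l g`: the list `l` is a word on `S ∪ S⁻¹` that represents `g`. -/
def IsWord {G : Type*} [Group G] (S : Set G) (l : List G) (g : G) : Prop :=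
  (∀ x ∈ l, x ∈ S ∨ x⁻¹ ∈ S) ∧ l.prod = g

/-- `wordNorm S g` is the word metric distance `d_S(1, g)`, the length of a shortest word
on `S ∪ S⁻¹` that represents `g`. It is used only for sets `S` that generate `G`. -/
noncomputable def wordNorm {G : Type*} [Group G] (S : Set G) (g : G) : ℕ :=
  sInf {n : ℕ | ∃ l : List G, IsWord S l g ∧ l.length = n}

/-- The distortion function of a subgroup `H` of `G` with respect to a finite generating set
`S` of `G` and a finite generating set `T` of `H`:
`n ↦ max {d_T(1, h) | h ∈ H, d_S(1, h) ≤ n}`.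
The maximum exists, see `isGreatest_distortion`. -/
noncomputable def distortion {G : Type*} [Group G] (H : Subgroup G) (S : Set G) (T : Set H)
    (n : ℕ) : ℕ :=
  sSup {m : ℕ | ∃ h : H, wordNorm S (h : G) ≤ n ∧ wordNorm T h = m}

theorem exists_isWord {G : Type*} [Group G] {S : Set G} (hS : Subgroup.closure S = ⊤) (g : G) :
    ∃ l : List G, IsWord S l g := by
  have hg' : g ∈ Submonoid.closure (S ∪ S⁻¹) := by
    rw [← Subgroup.closure_toSubmonoid, hS]; trivial
  obtain ⟨l, hl, hg⟩ := Submonoid.exists_list_of_mem_closure hg'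
  exact ⟨l, hl, hg⟩

/-- For a generating set, `wordNorm` is the length of some word for `g`, and minimal. -/
theorem isLeast_wordNorm {G : Type*} [Group G] {S : Set G} (hS : Subgroup.closure S = ⊤)
    (g : G) :
    IsLeast {n : ℕ | ∃ l : List G, IsWord S l g ∧ l.length = n} (wordNorm S g) := by
  obtain ⟨l, hl⟩ := exists_isWord hS g
  exact ⟨Nat.sInf_mem ⟨l.length, l, hl, rfl⟩, fun m hm => Nat.sInf_le hm⟩

theorem finite_ball {G : Type*} [Group G] {S : Set G} (hfin : S.Finite)
    (hS : Subgroup.closure S = ⊤) (n : ℕ) : {g : G | wordNorm S g ≤ n}.Finite := by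
  have hU : (S ∪ S⁻¹).Finite := hfin.union hfin.inv
  have : Finite (S ∪ S⁻¹ : Set G) := hU
  refine ((List.finite_length_le (S ∪ S⁻¹ : Set G) n).image
    (fun l => (l.map Subtype.val).prod)).subset ?_
  intro g hg
  obtain ⟨l, ⟨hl, hprod⟩, hlen⟩ := (isLeast_wordNorm hS g).1
  have hl' : ∀ x ∈ l, x ∈ S ∪ S⁻¹ := fun x hx => hl x hx
  lift l to List (S ∪ S⁻¹ : Set G) using hl'
  refine ⟨l, ?_, hprod⟩
  have h1 : l.length = wordNorm S g := by simpa using hlen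
  have h2 : wordNorm S g ≤ n := hg
  show l.length ≤ n
  omega

/-- The distortion function is a maximum. -/
theorem isGreatest_distortion {G : Type*} [Group G] (H : Subgroup G) {S : Set G}
    (hfin : S.Finite) (hS : Subgroup.closure S = ⊤) (T : Set H) (n : ℕ) :
    IsGreatest {m : ℕ | ∃ h : H, wordNorm S (h : G) ≤ n ∧ wordNorm T h = m}
      (distortion H S T n) := by
  have hf : {m : ℕ | ∃ h : H, wordNorm S (h : G) ≤ n ∧ wordNorm T h = m}.Finite := by
    have h1 : {h : H | wordNorm S (h : G) ≤ n}.Finite :=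
      (finite_ball hfin hS n).preimage Subtype.val_injective.injOn
    refine (h1.image (wordNorm T)).subset ?_
    rintro m ⟨h, hh, rfl⟩
    exact ⟨h, hh, rfl⟩
  have h0 : wordNorm S ((1 : H) : G) ≤ n :=
    ((isLeast_wordNorm hS _).2 ⟨[], ⟨by simp, by simp⟩, rfl⟩).trans (Nat.zero_le n)
  exact ⟨Nat.sSup_mem ⟨_, 1, h0, rfl⟩ hf.bddAbove, fun m hm => le_csSup hf.bddAbove hm⟩

/-- The free-group generator `a_{i+1}`, for `i : Fin k` (so `a_1, …, a_k` are indexed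
by `0, …, k - 1`). -/
def freeA {k : ℕ} (i : Fin k) : FreeGroup (Option (Fin k)) := FreeGroup.of (some i)

/-- The free-group generator `t`. -/
def freeT (k : ℕ) : FreeGroup (Option (Fin k)) := FreeGroup.of none

/-- The relators of `G_k`, from the relations `t⁻¹ a_1 t = a_1` and
`t⁻¹ a_i t = a_i a_{i-1}` for `1 < i ≤ k`. -/
def relators (k : ℕ) : Set (FreeGroup (Option (Fin k))) :=
  {r | (∃ h : 0 < k,
          r = (freeT k)⁻¹ * freeA ⟨0, h⟩ * freeT k * (freeA ⟨0, h⟩)⁻¹) ∨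
       (∃ (i : ℕ) (h : i + 1 < k),
          r = (freeT k)⁻¹ * freeA ⟨i + 1, h⟩ * freeT k *
            (freeA ⟨i + 1, h⟩ * freeA ⟨i, Nat.lt_of_succ_lt h⟩)⁻¹)}

/-- The hydra group
`G_k = ⟨a_1, …, a_k, t | t⁻¹ a_1 t = a_1, t⁻¹ a_i t = a_i a_{i-1} (1 < i ≤ k)⟩`. -/
abbrev G (k : ℕ) : Type := PresentedGroup (relators k)

/-- The element `a_{i+1}` of `G_k`, for `i : Fin k`. -/
def a {k : ℕ} (i : Fin k) : G k := PresentedGroup.of (some i)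

/-- The element `t` of `G_k`. -/
def t (k : ℕ) : G k := PresentedGroup.of none

/-- The subgroup `H_k = ⟨a_1 t, …, a_k t⟩` of `G_k`. -/
def H (k : ℕ) : Subgroup (G k) := Subgroup.closure (Set.range fun i : Fin k => a i * t k)

end Hydra

namespace Hydra

/-! `G (k + 2)` is treated as an HNN extension of `G (k + 1)`: its last generator `a` is a stable
letter with `a b = t a`, where `b = t a_{k+1}⁻¹` (`exists_stableExt`). The new subgroup is generated
by the old `H` and `a t`. As the old `H` avoids the associated cyclic subgroups (`Malnormal`),
products of `H`-syllables stay reduced in the HNN extension (`reduced_conv`).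

By Britton's lemma an equation `t^r u = h t^s` with `h` in the new subgroup can therefore be read
syllable by syllable: each stable letter of `u` matches one letter `(a t)^{±1}` of `h` (`traverse`).
Between letters only a problem of lower rank remains: bounding the exponent left over and the length
of the piece of `h`. This is `Control`. Crossing a letter exchanges powers of `t` and `b`, and `b^l`
is `t^l` times a word of polynomial length (`exists_b_zpow`). So `m` syllables cost `m + 1`
iterations of a function of the same Ackermann level as the bound in lower rank, and linearly many
iterations raise the level by one (`exists_iterate_le`).

Control of the exponents of `b` splits by sign: positive powers are visible as runs of stable
letters (`le_of_edge_eq`), negative ones reduce to powers of `t` (`inv_mul_zpow_mem`).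

Finally, moving all `t` to the front of a word of length `n` makes the entries polynomially long but
leaves at most `n` stable letters (`exists_sylBall`). The polynomial only enters the starting value
of the iteration, so the argument of `A` stays linear. -/

/-! ### Balls of words -/

/-- The elements represented by words of length at most `n` on `S ∪ S⁻¹`. -/
def ball {Γ : Type*} [Group Γ] (S : Set Γ) (n : ℕ) : Set Γ :=
  {g | ∃ l : List Γ, IsWord S l g ∧ l.length ≤ n}

section ball
variable {Γ Δ : Type*} [Group Γ] [Group Δ] {S : Set Γ} {m n : ℕ} {g h : Γ}

theorem one_mem_ball : (1 : Γ) ∈ ball S n := ⟨[], ⟨by simp, by simp⟩, by simp⟩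

theorem mem_ball_one (hg : g ∈ S) : g ∈ ball S 1 := ⟨[g], ⟨by simp [hg], by simp⟩, by simp⟩

theorem ball_mono (h : m ≤ n) : ball S m ⊆ ball S n := fun _ ⟨l, hl, hn⟩ => ⟨l, hl, hn.trans h⟩

theorem ball_subset_ball {S' : Set Γ} (h : S ⊆ S') : ball S n ⊆ ball S' n :=
  fun _ ⟨l, hl, hn⟩ => ⟨l, ⟨fun x hx => (hl.1 x hx).imp (@h _) (@h _), hl.2⟩, hn⟩

theorem mul_mem_ball (hg : g ∈ ball S m) (hh : h ∈ ball S n) : g * h ∈ ball S (m + n) := by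
  obtain ⟨l, ⟨hl, rfl⟩, hm⟩ := hg
  obtain ⟨l', ⟨hl', rfl⟩, hn⟩ := hh
  refine ⟨l ++ l', ⟨?_, by simp⟩, by simp; omega⟩
  intro x hx
  rcases List.mem_append.1 hx with hx | hx
  exacts [hl x hx, hl' x hx]

theorem inv_mem_ball (hg : g ∈ ball S m) : g⁻¹ ∈ ball S m := by
  obtain ⟨l, ⟨hl, rfl⟩, hm⟩ := hg
  refine ⟨(l.map (·⁻¹)).reverse, ⟨?_, by rw [List.prod_inv_reverse]⟩, by simpa⟩
  intro x hx
  simp only [List.mem_reverse, List.mem_map] at hx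
  obtain ⟨y, hy, rfl⟩ := hx
  simpa using (hl y hy).symm

theorem zpow_mem_ball (hg : g ∈ S) (m : ℤ) :
    g ^ m ∈ ball S m.natAbs := by
  have key : ∀ n : ℕ, g ^ n ∈ ball S n := by
    intro n
    induction n with
    | zero => rw [pow_zero]; exact one_mem_ball
    | succ n ih => exact pow_succ g n ▸ mul_mem_ball ih (mem_ball_one hg)
  rcases Int.natAbs_eq m with h | h
  · rw [h, zpow_natCast]; exact key _
  · rw [h, zpow_neg, zpow_natCast, Int.natAbs_neg]; exact inv_mem_ball (key _)

theorem map_mem_ball (f : Γ →* Δ) (hg : g ∈ ball S m) : f g ∈ ball (f '' S) m := by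
  obtain ⟨l, ⟨hl, rfl⟩, hm⟩ := hg
  refine ⟨l.map f, ⟨?_, by rw [map_list_prod]⟩, by simpa⟩
  intro x hx
  obtain ⟨y, hy, rfl⟩ := List.mem_map.1 hx
  exact (hl y hy).imp (fun h => ⟨y, h, rfl⟩) (fun h => ⟨y⁻¹, h, by simp⟩)

theorem mem_closure_of_mem_ball (hg : g ∈ ball S m) : g ∈ Subgroup.closure S := by
  obtain ⟨l, ⟨hl, rfl⟩, -⟩ := hg
  refine Subgroup.list_prod_mem _ fun x hx => ?_
  rcases hl x hx with h | h
  · exact Subgroup.subset_closure h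
  · simpa using (Subgroup.closure S).inv_mem (Subgroup.subset_closure h)

/-- Induction on words, by left multiplication with letters. -/
theorem ball_induction {p : ℕ → Γ → Prop} (one : p 0 1)
    (mul : ∀ n x g, x ∈ S → p n g → p (n + 1) (x * g))
    (inv : ∀ n x g, x ∈ S → p n g → p (n + 1) (x⁻¹ * g))
    (mono : ∀ m n g, m ≤ n → p m g → p n g) (hg : g ∈ ball S n) : p n g := by
  obtain ⟨l, ⟨hl, rfl⟩, hn⟩ := hg
  refine mono _ _ _ hn ?_
  clear hn
  induction l with
  | nil => exact one
  | cons x l ih =>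
    rw [List.prod_cons]
    have ih := ih fun y hy => hl y (List.mem_cons_of_mem _ hy)
    rcases hl x List.mem_cons_self with h | h
    · exact mul _ _ _ h ih
    · simpa using inv _ _ _ h ih

theorem exists_map_eq_of_mem_ball_image (f : Γ →* Δ) {x : Δ} (hx : x ∈ ball (f '' S) n) :
    ∃ g ∈ ball S n, f g = x := by
  refine ball_induction (p := fun n x => ∃ g ∈ ball S n, f g = x) ⟨1, one_mem_ball, map_one f⟩
    ?_ ?_ ?_ hx
  · rintro n _ _ ⟨y, hy, rfl⟩ ⟨g, hg, rfl⟩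
    exact ⟨y * g, ball_mono (by omega) (mul_mem_ball (mem_ball_one hy) hg), map_mul f _ _⟩
  · rintro n _ _ ⟨y, hy, rfl⟩ ⟨g, hg, rfl⟩
    exact ⟨y⁻¹ * g, ball_mono (by omega) (mul_mem_ball (inv_mem_ball (mem_ball_one hy)) hg),
      by simp⟩
  · rintro m n _ hmn ⟨g, hg, rfl⟩
    exact ⟨g, ball_mono hmn hg, rfl⟩

theorem mem_ball_of_subset_ball {S' : Set Γ} {c : ℕ} (h : S ⊆ ball S' c) (hg : g ∈ ball S n) :
    g ∈ ball S' (n * c) := by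
  refine ball_induction (p := fun n g => g ∈ ball S' (n * c)) one_mem_ball ?_ ?_ ?_ hg
  · intro n x g hx hg
    exact ball_mono (by ring_nf; rfl) (mul_mem_ball (h hx) hg)
  · intro n x g hx hg
    exact ball_mono (by ring_nf; rfl) (mul_mem_ball (inv_mem_ball (h hx)) hg)
  · intro m n g hmn hg
    exact ball_mono (Nat.mul_le_mul_right _ hmn) hg

theorem map_eq_one_of_mem_ball (f : Γ →* Δ) (hf : ∀ x ∈ S, f x = 1) (hg : g ∈ ball S n) :
    f g = 1 := by
  have : Subgroup.closure S ≤ f.ker := (Subgroup.closure_le _).2 hf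
  exact this (mem_closure_of_mem_ball hg)

theorem wordNorm_le_of_mem_ball (hg : g ∈ ball S n) : wordNorm S g ≤ n := by
  obtain ⟨l, hl, hn⟩ := hg
  have : wordNorm S g ≤ l.length := Nat.sInf_le ⟨l, hl, rfl⟩
  exact this.trans hn

theorem mem_ball_wordNorm (hS : Subgroup.closure S = ⊤) (g : Γ) : g ∈ ball S (wordNorm S g) := by
  obtain ⟨l, hl, hn⟩ : ∃ l, IsWord S l g ∧ l.length = wordNorm S g := (isLeast_wordNorm hS g).1
  exact ⟨l, hl, hn.le⟩

theorem exists_subset_ball (hS : Subgroup.closure S = ⊤) {F : Set Γ} (hF : F.Finite) :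
    ∃ c, F ⊆ ball S c := by
  obtain ⟨c, hc⟩ := (hF.image (wordNorm S)).bddAbove
  exact ⟨c, fun x hx => ball_mono (hc ⟨x, hx, rfl⟩) (mem_ball_wordNorm hS x)⟩

end ball

/-! ### Growth of Ackermann's functions -/

theorem A_succ_succ (k n : ℕ) : A (k + 1) (n + 1) = A k (A (k + 1) n) := by
  rw [A]

theorem A_one (n : ℕ) : A 1 n = 2 * n := by
  induction n with
  | zero => simp [A]
  | succ n ih => rw [A_succ_succ, ih, A]; ring

theorem A_add_two (k n : ℕ) : A (k + 2) n = (A (k + 1))^[n] 1 := by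
  induction n with
  | zero => simp [A]
  | succ n ih => rw [A_succ_succ, ih, Function.iterate_succ_apply']

theorem two_mul_le_A (k : ℕ) : ∀ n, 2 * n ≤ A (k + 1) n ∧ (1 ≤ k → 2 ^ n ≤ A (k + 1) n) := by
  induction k with
  | zero => intro n; simp [A_one]
  | succ k ih =>
    have key : ∀ n, 2 ^ n ≤ A (k + 2) n := by
      intro n
      induction n with
      | zero => simp [A]
      | succ n ihn =>
        rw [A_succ_succ]
        have := (ih (A (k + 2) n)).1
        rw [pow_succ]; change _ ≤ A (k + 1) (A (k + 2) n); omega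
    intro n
    refine ⟨le_trans ?_ (key n), fun _ => key n⟩
    rcases n with _ | n
    · simp
    · have := Nat.lt_two_pow_self (n := n)
      rw [pow_succ]; omega

theorem two_pow_le_A (k n : ℕ) : 2 ^ n ≤ A (k + 2) n := (two_mul_le_A (k + 1) n).2 (by omega)

theorem monotone_A (k : ℕ) : Monotone (A (k + 1)) := by
  refine monotone_nat_of_le_succ fun n => ?_
  cases k with
  | zero => simp [A_one]
  | succ k => rw [A_succ_succ]; exact (Nat.le_mul_of_pos_left _ two_pos).trans (two_mul_le_A k _).1

theorem two_pow_mul_le_iterate (k p n : ℕ) : 2 ^ p * n ≤ (A (k + 1))^[p] n := by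
  induction p with
  | zero => simp
  | succ p ih =>
    rw [Function.iterate_succ_apply']
    have := (two_mul_le_A k ((A (k + 1))^[p] n)).1
    rw [pow_succ]; linarith

theorem le_iterate (k p n : ℕ) : n ≤ (A (k + 1))^[p] n :=
  le_trans (Nat.le_mul_of_pos_left _ (by positivity)) (two_pow_mul_le_iterate k p n)

theorem iterate_mono (k : ℕ) {p q m n : ℕ} (hpq : p ≤ q) (hmn : m ≤ n) :
    (A (k + 1))^[p] m ≤ (A (k + 1))^[q] n := by
  obtain ⟨d, rfl⟩ := Nat.exists_eq_add_of_le hpq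
  rw [Function.iterate_add_apply]
  exact ((monotone_A k).iterate p) (hmn.trans (le_iterate k d n))

theorem mul_le_iterate (k p n : ℕ) : p * n ≤ (A (k + 1))^[p] n :=
  le_trans (Nat.mul_le_mul_right _ Nat.lt_two_pow_self.le) (two_pow_mul_le_iterate k p n)

/-- `f` is bounded by a fixed number of iterations of `A k`, up to a shift by one. -/
def IterBdd (k : ℕ) (f : ℕ → ℕ) : Prop := ∃ p, ∀ n, f n + 1 ≤ (A k)^[p] (n + 1)

theorem IterBdd.mono {k : ℕ} {f g : ℕ → ℕ} (hg : IterBdd k g) (h : ∀ n, f n ≤ g n) :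
    IterBdd k f := by
  obtain ⟨p, hp⟩ := hg
  exact ⟨p, fun n => (Nat.succ_le_succ (h n)).trans (hp n)⟩

theorem iterBdd_id (k : ℕ) : IterBdd k fun n => n := ⟨0, fun _ => le_rfl⟩

theorem IterBdd.comp {k : ℕ} {f g : ℕ → ℕ} (hf : IterBdd (k + 1) f) (hg : IterBdd (k + 1) g) :
    IterBdd (k + 1) fun n => f (g n) := by
  obtain ⟨p, hp⟩ := hf
  obtain ⟨q, hq⟩ := hg
  refine ⟨p + q, fun n => (hp _).trans ?_⟩
  rw [Function.iterate_add_apply]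
  exact iterate_mono k le_rfl (hq n)

theorem IterBdd.add {k : ℕ} {f g : ℕ → ℕ} (hf : IterBdd (k + 1) f) (hg : IterBdd (k + 1) g) :
    IterBdd (k + 1) fun n => f n + g n := by
  obtain ⟨p, hp⟩ := hf
  obtain ⟨q, hq⟩ := hg
  refine ⟨max p q + 1, fun n => ?_⟩
  rw [Function.iterate_succ_apply']
  have h1 := (hp n).trans (iterate_mono k (le_max_left p q) le_rfl)
  have h2 := (hq n).trans (iterate_mono k (le_max_right p q) le_rfl)
  have h3 := (two_mul_le_A k ((A (k + 1))^[max p q] (n + 1))).1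
  change f n + g n + 1 ≤ _
  omega

/-- The shift by one matters here: `A 1` fixes `0`, whereas iterates started at `n + 1 ≥ 1` exceed
every constant. -/
theorem iterBdd_const (k c : ℕ) : IterBdd (k + 1) fun _ => c := by
  refine ⟨c + 1, fun n => ?_⟩
  refine le_trans ?_ (mul_le_iterate k (c + 1) (n + 1))
  nlinarith

/-- From level two on `A` dominates `2 ^ n`, and `z ^ c ≤ 2 ^ (c * z)`, so powers cost boundedly
many iterations. -/
theorem IterBdd.add_one_pow {k c : ℕ} {f : ℕ → ℕ} (hf : IterBdd (k + 2) f) :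
    IterBdd (k + 2) fun n => (f n + 1) ^ c := by
  obtain ⟨p, hp⟩ := hf
  refine ⟨1 + (1 + (c + p)), fun n => ?_⟩
  set z := (A (k + 2))^[p] (n + 1) with hz
  have h1 : (f n + 1) ^ c ≤ 2 ^ (c * z) := by
    rw [mul_comm, pow_mul]
    exact Nat.pow_le_pow_left ((hp n).trans Nat.lt_two_pow_self.le) _
  have h2 : 2 ^ (c * z) ≤ (A (k + 2))^[1 + (c + p)] (n + 1) := by
    rw [Function.iterate_add_apply, Function.iterate_add_apply, ← hz]
    exact (Nat.pow_le_pow_right (by norm_num) (mul_le_iterate (k + 1) c z)).trans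
      (two_pow_le_A k _)
  have h3 := (two_mul_le_A (k + 1) ((A (k + 2))^[1 + (c + p)] (n + 1))).1
  rw [Function.iterate_add_apply]
  have h4 : 0 < (f n + 1) ^ c := by positivity
  simp only [Function.iterate_one]
  change 2 * _ ≤ A (k + 2) _ at h3
  omega

/-- Iterating a function at level `k` linearly often, from polynomially large values, stays within
level `k + 1`. -/
theorem exists_iterate_le {k : ℕ} {D : ℕ → ℕ} (hD : IterBdd (k + 1) D) (c : ℕ) :
    ∃ C, ∀ n, D^[n + 1] (n * (n + 1) ^ c) + 1 ≤ A (k + 2) (C * (n + 1)) := by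
  obtain ⟨p, hp⟩ := hD
  have h1 : ∀ m x, D^[m] x + 1 ≤ (A (k + 1))^[m * p] (x + 1) := by
    intro m
    induction m with
    | zero => intro x; simp
    | succ m ih =>
      intro x
      rw [Function.iterate_succ_apply, Nat.succ_mul, Function.iterate_add_apply]
      exact (ih _).trans (iterate_mono k le_rfl (hp x))
  -- `p` iterates of `A (k + 1)` pay for each of the `n + 1` applications of `D`; a further `(c + 1)
  -- * (n + 1)` iterates reach the starting value from `1`.
  refine ⟨p + (c + 1), fun n => (h1 _ _).trans ?_⟩
  have h2 : n * (n + 1) ^ c + 1 ≤ (A (k + 1))^[(c + 1) * (n + 1)] 1 := by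
    refine le_trans ?_ (two_pow_mul_le_iterate k _ 1)
    have : n * (n + 1) ^ c + 1 ≤ (n + 1) ^ (c + 1) := by
      rw [pow_succ]
      have : 1 ≤ (n + 1) ^ c := Nat.one_le_pow _ _ (by omega)
      nlinarith
    refine this.trans ?_
    rw [mul_one, mul_comm, pow_mul]
    exact Nat.pow_le_pow_left Nat.lt_two_pow_self.le _
  rw [A_add_two]
  calc _ ≤ _ := iterate_mono k le_rfl h2
    _ = _ := by rw [← Function.iterate_add_apply]; ring_nf

/-! ### Syllables and normal forms over a stable letter -/

section StableLetter
variable {K E : Type*} [Group K] [Group E]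

/-- The subgroup of `K` which is conjugated into `K` by the stable letter to the power `u`. -/
def edge (t b : K) (u : ℤˣ) : Subgroup K :=
  if u = 1 then Subgroup.zpowers b else Subgroup.zpowers t

/-- Syllable lists without pinches. -/
def Reduced (t b : K) (W : List (ℤˣ × K)) : Prop :=
  W.IsChain fun x y => x.2 ∈ edge t b x.1 → x.1 = y.1

/-- The element of `E` given by a list of syllables `a ^ u * ι g`. -/
def syl (ι : K →* E) (a : E) (W : List (ℤˣ × K)) : E :=
  (W.map fun x => a ^ (x.1 : ℤ) * ι x.2).prod

/-- An overgroup `E` of `K` containing an element `a` that conjugates `t` to `b`, in which the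
normal form theorem of HNN extensions holds. -/
structure StableExt (K E : Type*) [Group K] [Group E] where
  ι : K →* E
  t : K
  b : K
  a : E
  τ : K →* Multiplicative ℤ
  ι_inj : Function.Injective ι
  τ_t : τ t = Multiplicative.ofAdd 1
  τ_b : τ b = Multiplicative.ofAdd 1
  rel : a * ι b = ι t * a
  britton : ∀ {g g' : K} {W W' : List (ℤˣ × K)}, Reduced t b W → Reduced t b W' →
    ι g * syl ι a W = ι g' * syl ι a W' →
    W.map Prod.fst = W'.map Prod.fst ∧
      ∀ u ∈ W.head?.map Prod.fst, g⁻¹ * g' ∈ edge t b (-u)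

theorem zpow_eq_one_of_map {τ : K →* Multiplicative ℤ} {x : K}
    (hx : τ x = Multiplicative.ofAdd 1) {n : ℤ} (h : τ (x ^ n) = 1) : n = 0 := by
  rw [map_zpow, hx, ← ofAdd_zsmul] at h
  simpa using h

@[simp] theorem syl_nil (ι : K →* E) (a : E) : syl ι a [] = 1 := rfl

@[simp] theorem syl_cons (ι : K →* E) (a : E) (x : ℤˣ × K) (W : List (ℤˣ × K)) :
    syl ι a (x :: W) = a ^ (x.1 : ℤ) * ι x.2 * syl ι a W := by
  simp [syl]

namespace StableExt
variable (X : StableExt K E)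

theorem rel_zpow (l : ℤ) : X.a * X.ι (X.b ^ l) = X.ι (X.t ^ l) * X.a := by
  have h : X.ι X.t = X.a * X.ι X.b * X.a⁻¹ := by rw [X.rel]; group
  rw [map_zpow, map_zpow, h, conj_zpow]; group

theorem rel_zpow' (l : ℤ) : X.ι (X.b ^ l) * X.a⁻¹ = X.a⁻¹ * X.ι (X.t ^ l) := by
  have := X.rel_zpow l
  rw [eq_inv_mul_iff_mul_eq, ← mul_assoc, this]; group

theorem eq_one_of_mem_edge {x : K} {u : ℤˣ} (hx : x ∈ edge X.t X.b u) (h : X.τ x = 1) : x = 1 := by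
  unfold edge at hx
  split_ifs at hx
  all_goals
    obtain ⟨n, rfl⟩ := hx
    dsimp only at h ⊢
  · rw [zpow_eq_one_of_map X.τ_b h, zpow_zero]
  · rw [zpow_eq_one_of_map X.τ_t h, zpow_zero]

/-! ### Syllable form of words in the letters of `K` and `a` -/

/-- Elements with a reduced syllable form with at most `m` syllables, all of whose entries in `K`
are words of length at most `M` on `S`. -/
def SylBall (S : Set K) (m M : ℕ) (u : E) : Prop :=
  ∃ u₀ W, Reduced X.t X.b W ∧ u = X.ι u₀ * syl X.ι X.a W ∧ W.length ≤ m ∧ u₀ ∈ ball S M ∧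
    ∀ x ∈ W, x.2 ∈ ball S M

variable {X} {S HS : Set K}

theorem SylBall.mono {m n M N : ℕ} {u : E} (h : X.SylBall S m M u) (hmn : m ≤ n) (hMN : M ≤ N) :
    X.SylBall S n N u := by
  obtain ⟨u₀, W, hW, hu, hm, h0, hM⟩ := h
  exact ⟨u₀, W, hW, hu, hm.trans hmn, ball_mono hMN h0, fun x hx => ball_mono hMN (hM x hx)⟩

theorem sylBall_one {m M : ℕ} : X.SylBall S m M 1 :=
  ⟨1, [], List.isChain_nil, by simp, by simp, one_mem_ball, by simp⟩

theorem SylBall.base_mul {m M c : ℕ} {u : E} (h : X.SylBall S m M u) {v : K} (hv : v ∈ ball S c) :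
    X.SylBall S m (M + c) (X.ι v * u) := by
  obtain ⟨u₀, W, hW, rfl, hm, h0, hM⟩ := h
  refine ⟨v * u₀, W, hW, by simp [mul_assoc], hm, ?_, fun x hx => ball_mono (by omega) (hM x hx)⟩
  rw [add_comm]
  exact mul_mem_ball hv h0

/-- Entries are words on `S`, on which `τ` vanishes, while `τ` is injective on the associated
subgroups. A pinch therefore has trivial entry and cancels freely, without lengthening any entry. -/
theorem SylBall.zpow_mul (hS : ∀ x ∈ S, X.τ x = 1) {m M : ℕ} {u : E} (h : X.SylBall S m M u)
    (ε : ℤˣ) : X.SylBall S (m + 1) M (X.a ^ (ε : ℤ) * u) := by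
  obtain ⟨u₀, W, hW, rfl, hm, h0, hM⟩ := h
  by_cases hc : ∀ y ∈ W.head?, u₀ ∈ edge X.t X.b ε → ε = y.1
  · refine ⟨1, (ε, u₀) :: W, List.isChain_cons.2 ⟨hc, hW⟩, by simp [mul_assoc], by simpa,
      one_mem_ball, ?_⟩
    intro x hx
    rcases List.mem_cons.1 hx with rfl | hx
    exacts [h0, hM x hx]
  · push Not at hc
    obtain ⟨⟨δ, g⟩, hy, hu, hne⟩ := hc
    cases W with
    | nil => simp at hy
    | cons y W =>
      obtain rfl : y = (δ, g) := by simpa using hy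
      have h1 : u₀ = 1 := X.eq_one_of_mem_edge hu (map_eq_one_of_mem_ball _ hS h0)
      have h2 : ε = -δ := Int.units_ne_iff_eq_neg.1 hne
      subst h1 h2
      refine ⟨g, W, (List.isChain_cons.1 hW).2, by simp [mul_assoc], ?_,
        hM (δ, g) List.mem_cons_self, fun x hx => hM x (List.mem_cons_of_mem _ hx)⟩
      simp at hm; omega

theorem sylBall_of_mem_ball (hS : ∀ x ∈ S, X.τ x = 1) {n : ℕ} {u : E}
    (hu : u ∈ ball (insert X.a (X.ι '' S)) n) : X.SylBall S n n u := by
  refine ball_induction (p := fun n u => X.SylBall S n n u) sylBall_one ?_ ?_ ?_ hu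
  · rintro n x g (rfl | ⟨y, hy, rfl⟩) hg
    · simpa using (hg.zpow_mul hS 1).mono le_rfl (Nat.le_succ n)
    · exact (hg.base_mul (mem_ball_one hy)).mono (Nat.le_succ n) le_rfl
  · rintro n x g (rfl | ⟨y, hy, rfl⟩) hg
    · simpa using (hg.zpow_mul hS (-1)).mono le_rfl (Nat.le_succ n)
    · rw [← map_inv]
      exact (hg.base_mul (inv_mem_ball (mem_ball_one hy))).mono (Nat.le_succ n) le_rfl
  · exact fun m n g h hg => hg.mono h h

/-! ### Syllable form of elements of the subgroup generated by `H` and `a * t` -/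

variable (X) in
/-- The element of `E` given by a list of syllables `(a * t) ^ u * h`. -/
def hsyl (L : List (ℤˣ × K)) : E :=
  (L.map fun x => (X.a * X.ι X.t) ^ (x.1 : ℤ) * X.ι x.2).prod

variable (X) in
@[simp] theorem hsyl_nil : X.hsyl [] = 1 := rfl

variable (X) in
@[simp] theorem hsyl_cons (x : ℤˣ × K) (L : List (ℤˣ × K)) :
    X.hsyl (x :: L) = (X.a * X.ι X.t) ^ (x.1 : ℤ) * X.ι x.2 * X.hsyl L := by
  simp [hsyl]

/-- Lists of syllables with entries in `H` that are reduced as elements of a free product. -/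
def FreeReduced (H : Subgroup K) (L : List (ℤˣ × K)) : Prop :=
  (∀ x ∈ L, x.2 ∈ H) ∧ L.IsChain fun x y => x.2 = 1 → x.1 = y.1

theorem FreeReduced.tail {H : Subgroup K} {x : ℤˣ × K} {L : List (ℤˣ × K)}
    (h : FreeReduced H (x :: L)) : FreeReduced H L :=
  ⟨fun y hy => h.1 y (List.mem_cons_of_mem _ hy), (List.isChain_cons.1 h.2).2⟩

theorem FreeReduced.head_mem {H : Subgroup K} {x : ℤˣ × K} {L : List (ℤˣ × K)}
    (h : FreeReduced H (x :: L)) : x.2 ∈ H := h.1 x List.mem_cons_self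

theorem exists_hsyl_zpow_mul {H : Subgroup K} {h₀ : K} (hh : h₀ ∈ H) {L : List (ℤˣ × K)}
    (hL : FreeReduced H L) (ε : ℤˣ) : ∃ h₁ ∈ H, ∃ L', FreeReduced H L' ∧
      (X.a * X.ι X.t) ^ (ε : ℤ) * (X.ι h₀ * X.hsyl L) = X.ι h₁ * X.hsyl L' := by
  by_cases hc : ∀ y ∈ L.head?, h₀ = 1 → ε = y.1
  · refine ⟨1, H.one_mem, (ε, h₀) :: L, ⟨?_, List.isChain_cons.2 ⟨hc, hL.2⟩⟩, by simp [mul_assoc]⟩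
    intro x hx
    rcases List.mem_cons.1 hx with rfl | hx
    exacts [hh, hL.1 x hx]
  · push Not at hc
    obtain ⟨⟨δ, g⟩, hy, h1, hne⟩ := hc
    cases L with
    | nil => simp at hy
    | cons y L =>
      obtain rfl : y = (δ, g) := by simpa using hy
      have h2 : ε = -δ := Int.units_ne_iff_eq_neg.1 hne
      subst h1 h2
      exact ⟨g, hL.head_mem, L, hL.tail, by simp [mul_assoc]⟩

theorem exists_hsyl {h : E}
    (hh : h ∈ Subgroup.closure (insert (X.a * X.ι X.t) (X.ι '' HS))) :
    ∃ h₀ ∈ Subgroup.closure HS, ∃ L, FreeReduced (Subgroup.closure HS) L ∧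
      h = X.ι h₀ * X.hsyl L := by
  induction hh using Subgroup.closure_induction_left with
  | one => exact ⟨1, one_mem _, [], ⟨by simp, List.isChain_nil⟩, by simp⟩
  | mul_left x hx y _ ih =>
    obtain ⟨h₀, hh, L, hL, rfl⟩ := ih
    rcases hx with rfl | ⟨z, hz, rfl⟩
    · simpa using exists_hsyl_zpow_mul (X := X) hh hL 1
    · exact ⟨z * h₀, mul_mem (Subgroup.subset_closure hz) hh, L, hL, by simp [mul_assoc]⟩
  | inv_mul_cancel x hx y _ ih =>
    obtain ⟨h₀, hh, L, hL, rfl⟩ := ih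
    rcases hx with rfl | ⟨z, hz, rfl⟩
    · simpa using exists_hsyl_zpow_mul (X := X) hh hL (-1)
    · exact ⟨z⁻¹ * h₀, mul_mem (inv_mem (Subgroup.subset_closure hz)) hh, L, hL,
        by simp [mul_assoc]⟩

/-- The element that ends the syllable before `L` in `conv`. -/
def pre (t z : K) : List (ℤˣ × K) → K
  | [] => z
  | x :: _ => if x.1 = -1 then t⁻¹ else 1

/-- The syllables in `a` of the product of the syllables `L` in `a * t` with `z` and the syllables
`Y`. -/
def conv (t z : K) (Y : List (ℤˣ × K)) : List (ℤˣ × K) → List (ℤˣ × K)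
  | [] => Y
  | x :: L => (x.1, (if x.1 = 1 then t else 1) * x.2 * pre t z L) :: conv t z Y L

/-- A letter `a t` puts its `t` at the start of its own entry; `(a t)⁻¹ = t⁻¹ a⁻¹` puts `t⁻¹` at the
end of the preceding one. -/
theorem syl_conv (z : K) (Y L : List (ℤˣ × K)) (h : K) :
    X.ι h * X.hsyl L * (X.ι z * syl X.ι X.a Y) =
      X.ι (h * pre X.t z L) * syl X.ι X.a (conv X.t z Y L) := by
  induction L generalizing h with
  | nil => simp [pre, conv, mul_assoc]
  | cons x L ih =>
    obtain ⟨ε, g⟩ := x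
    have ih := ih g
    rcases Int.units_eq_one_or ε with rfl | rfl
    · simp only [hsyl_cons, conv, pre, syl_cons, map_mul, mul_assoc] at ih ⊢
      simp [ih, mul_assoc]
    · simp only [hsyl_cons, conv, pre, syl_cons, map_mul, mul_assoc] at ih ⊢
      simp [ih, mul_assoc]

theorem length_conv (t z : K) (Y L : List (ℤˣ × K)) :
    (conv t z Y L).length = L.length + Y.length := by
  induction L with
  | nil => simp [conv]
  | cons x L ih => simp [conv, ih]; omega

/-- `H` meets the subgroups associated to `a * t` trivially. -/
structure Malnormal (t b : K) (H : Subgroup K) : Prop where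
  eq_one_of_mem_zpowers : ∀ h ∈ H, h ∈ Subgroup.zpowers t → h = 1
  eq_one_of_conj_mem_zpowers : ∀ h ∈ H, t * h * t⁻¹ ∈ Subgroup.zpowers b → h = 1

/-- Only sign changes can produce pinches. From `+` to `-` the entry is `t g t⁻¹`, tested against
powers of `b`; from `-` to `+` it is `g`, tested against powers of `t`. These are the two clauses of
`Malnormal`. -/
theorem reduced_conv {t b : K} {H : Subgroup K} (hH : Malnormal t b H) {z : K}
    {Y : List (ℤˣ × K)} (hY : Reduced t b Y)
    (hzY : ∀ h ∈ H, ∀ ε : ℤˣ, ∀ y ∈ Y.head?,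
      (if ε = 1 then t else 1) * h * z ∈ edge t b ε → ε = y.1)
    {L : List (ℤˣ × K)} (hL : FreeReduced H L) : Reduced t b (conv t z Y L) := by
  induction L with
  | nil => exact hY
  | cons x L ih =>
    refine List.isChain_cons.2 ⟨?_, ih hL.tail⟩
    obtain ⟨ε, g⟩ := x
    cases L with
    | nil => exact fun y hy => hzY g hL.head_mem ε y hy
    | cons y L =>
      obtain ⟨δ, g'⟩ := y
      intro y hy hmem
      obtain rfl := by simpa [conv] using hy
      have hg : g ∈ H := hL.head_mem
      have hc : g = 1 → ε = δ := (List.isChain_cons.1 hL.2).1 (δ, g') (by simp)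
      rcases Int.units_eq_one_or ε with rfl | rfl <;> rcases Int.units_eq_one_or δ with rfl | rfl
      · rfl
      · refine hc (hH.eq_one_of_conj_mem_zpowers g hg ?_)
        simpa [edge, pre] using hmem
      · refine hc (hH.eq_one_of_mem_zpowers g hg ?_)
        simpa [edge, pre] using hmem
      · rfl

end StableExt
end StableLetter

/-! ### The bound for one step of the traversal -/

/-- The growth of the exponents and syllable lengths in one step of the traversal. -/
def stepBound (f p : ℕ → ℕ) (R : ℕ) : ℕ := 2 * (f (R + p (f R)) + R + p (f R) + f R + 1)

theorem monotone_stepBound {f p : ℕ → ℕ} (hf : Monotone f) (hp : Monotone p) :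
    Monotone (stepBound f p) := by
  intro m n h
  have h1 := hf h
  have h2 := hp h1
  have h3 : f (m + p (f m)) ≤ f (n + p (f n)) := hf (by omega)
  unfold stepBound; omega

/-- Lets the length contributed by one syllable be absorbed into the starting value of the remaining
iteration. -/
theorem stepBound_add_le {f p : ℕ → ℕ} (hf : Monotone f) (hp : Monotone p) (m n : ℕ) :
    stepBound f p m + n ≤ stepBound f p (m + n) := by
  have h1 := hf (Nat.le_add_right m n)
  have h2 := hp h1
  have h3 : f (m + p (f m)) ≤ f (m + n + p (f (m + n))) := hf (by omega)
  unfold stepBound; omega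

theorem iterate_stepBound_add_le {f p : ℕ → ℕ} (hf : Monotone f) (hp : Monotone p) (i m n : ℕ) :
    (stepBound f p)^[i] m + n ≤ (stepBound f p)^[i] (m + n) := by
  induction i generalizing m with
  | zero => simp
  | succ i ih =>
    rw [Function.iterate_succ_apply, Function.iterate_succ_apply]
    exact (ih _).trans ((monotone_stepBound hf hp).iterate i (stepBound_add_le hf hp m n))

theorem le_stepBound (f p : ℕ → ℕ) (n : ℕ) : n ≤ stepBound f p n := by
  unfold stepBound; omega

theorem iterate_stepBound_mono {f p : ℕ → ℕ} (hf : Monotone f) (hp : Monotone p) {i j m n : ℕ}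
    (hij : i ≤ j) (hmn : m ≤ n) : (stepBound f p)^[i] m ≤ (stepBound f p)^[j] n := by
  obtain ⟨d, rfl⟩ := Nat.exists_eq_add_of_le hij
  rw [Function.iterate_add_apply]
  exact (monotone_stepBound hf hp).iterate i
    (hmn.trans (Function.id_le_iterate_of_id_le (le_stepBound f p) d n))

theorem le_iterate_stepBound (f p : ℕ → ℕ) (i n : ℕ) : n ≤ (stepBound f p)^[i] n :=
  Function.id_le_iterate_of_id_le (le_stepBound f p) i n

/-- Quantitative control of the cosets `H t ^ s` for `H` generated by `HS` under words on `S`. -/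
structure Control {K : Type*} [Group K] (t b : K) (S HS : Set K) (f : ℕ → ℕ) : Prop where
  mono : Monotone f
  coset : ∀ {n : ℕ} {r s : ℤ} {u : K}, r.natAbs ≤ n → u ∈ ball S n →
    t ^ r * u * t ^ (-s) ∈ Subgroup.closure HS →
    s.natAbs ≤ f n ∧ t ^ r * u * t ^ (-s) ∈ ball HS (f n)
  edge : ∀ {n : ℕ} {r l : ℤ} {u : K}, r.natAbs ≤ n → u ∈ ball S n →
    t ^ r * u * b ^ (-l) * t ∈ Subgroup.closure HS → l.natAbs ≤ f n

/-! ### Syllable-by-syllable comparison with the subgroup -/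

namespace StableExt
variable {K E : Type*} [Group K] [Group E] {X : StableExt K E} {S HS : Set K} {f p : ℕ → ℕ}

/-- Both sides are reduced, so their first stable letters agree and their heads differ by an element
of an associated subgroup. `Control` bounds that element and the head `h`; cancelling the first
letter leaves an equation of the same shape with larger radius. -/
theorem traverse (hH : Malnormal X.t X.b (Subgroup.closure HS))
    (hf : Control X.t X.b S HS f) (hp : Monotone p)
    (hV : ∀ l : ℤ, ∃ v ∈ ball S (p l.natAbs), X.b ^ l = X.t ^ l * v)
    {N : ℕ} {W : List (ℤˣ × K)} (hW : Reduced X.t X.b W) (hWS : ∀ x ∈ W, x.2 ∈ ball S N)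
    {R : ℕ} {r s : ℤ} {u h : K} {L : List (ℤˣ × K)} (hNR : N ≤ R) (hr : r.natAbs ≤ R)
    (hu : u ∈ ball S R) (hh : h ∈ Subgroup.closure HS)
    (hL : FreeReduced (Subgroup.closure HS) L)
    (heq : X.ι (X.t ^ r * u) * syl X.ι X.a W = X.ι h * X.hsyl L * X.ι (X.t ^ s)) :
    s.natAbs ≤ (stepBound f p)^[W.length + 1] R ∧
      X.ι h * X.hsyl L ∈ ball (insert (X.a * X.ι X.t) (X.ι '' HS))
        ((stepBound f p)^[W.length + 1] R) := by
  induction W generalizing R r u h L with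
  | nil =>
    have hc := syl_conv (X := X) (X.t ^ s) [] L h
    rw [syl_nil, mul_one] at hc
    have hb := X.britton hW (reduced_conv hH (z := X.t ^ s) List.isChain_nil (by simp) hL)
      (heq.trans hc)
    have hLnil : L = [] := by
      have := congrArg List.length hb.1
      rw [List.length_map, List.length_map, length_conv] at this
      exact List.length_eq_zero_iff.1 (by simpa using this.symm)
    subst hLnil
    have he : X.t ^ r * u = h * X.t ^ s := X.ι_inj (by simpa using heq)
    have he' : X.t ^ r * u * X.t ^ (-s) = h := by rw [he]; group
    obtain ⟨h1, h2⟩ := hf.coset hr hu (he' ▸ hh)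
    rw [he'] at h2
    have hle : f R ≤ stepBound f p R := by
      have := hf.mono (Nat.le_add_right R (p (f R)))
      unfold stepBound; omega
    refine ⟨h1.trans hle, ?_⟩
    simpa using ball_mono hle (ball_subset_ball (Set.subset_insert _ _) (map_mem_ball X.ι h2))
  | cons x W ih =>
    obtain ⟨ε, g⟩ := x
    have hc := syl_conv (X := X) (X.t ^ s) [] L h
    rw [syl_nil, mul_one] at hc
    have hb := X.britton hW (reduced_conv hH (z := X.t ^ s) List.isChain_nil (by simp) hL)
      (heq.trans hc)
    cases L with
    | nil => simp [conv] at hb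
    | cons y L =>
      obtain ⟨δ, h'⟩ := y
      have hδ : ε = δ := by
        have := hb.1
        simp only [conv, List.map_cons, List.cons.injEq] at this
        exact this.1
      subst hδ
      have hmem := hb.2 ε (by simp)
      have hg : g ∈ ball S N := hWS (ε, g) List.mem_cons_self
      have hWS' : ∀ x ∈ W, x.2 ∈ ball S N := fun x hx => hWS x (List.mem_cons_of_mem _ hx)
      have hW' : Reduced X.t X.b W := (List.isChain_cons.1 hW).2
      have hfR := hf.mono (Nat.le_add_right R (p (f R)))
      -- it suffices to find the state after the first syllable
      have finish : ∀ (r' : ℤ) (u' : K), r'.natAbs ≤ f R + 1 → u' ∈ ball S (p (f R) + N) →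
          h ∈ ball HS (f (R + p (f R))) →
          X.ι (X.t ^ r' * u') * syl X.ι X.a W = X.ι h' * X.hsyl L * X.ι (X.t ^ s) →
          s.natAbs ≤ (stepBound f p)^[W.length + 1 + 1] R ∧
            X.ι h * X.hsyl ((ε, h') :: L) ∈ ball (insert (X.a * X.ι X.t) (X.ι '' HS))
              ((stepBound f p)^[W.length + 1 + 1] R) := by
        intro r' u' hr' hu' hhb he
        set c := f (R + p (f R)) + R + p (f R) + f R + 1 with hcdef
        obtain ⟨h1, h2⟩ := ih hW' hWS' (R := c) (by omega) (by omega)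
          (ball_mono (by omega) hu') hL.head_mem hL.tail he
        -- One `c` is the radius of the new state, the other pays for the word for `h` and the
        -- letter `(a t)^ε`.
        have hc2 : stepBound f p R = c + c := by unfold stepBound; omega
        have hle := iterate_stepBound_add_le hf.mono hp (W.length + 1) c c
        rw [Function.iterate_succ_apply, hc2]
        refine ⟨by omega, ?_⟩
        have hletter : (X.a * X.ι X.t) ^ (ε : ℤ) ∈
            ball (insert (X.a * X.ι X.t) (X.ι '' HS)) 1 := by
          have := mem_ball_one (Set.mem_insert (X.a * X.ι X.t) (X.ι '' HS))
          rcases Int.units_eq_one_or ε with rfl | rfl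
          · simpa using this
          · simpa using inv_mem_ball this
        have hb1 := ball_subset_ball (Set.subset_insert (X.a * X.ι X.t) _) (map_mem_ball X.ι hhb)
        have := mul_mem_ball (mul_mem_ball hb1 hletter) h2
        rw [hsyl_cons]
        simp only [mul_assoc] at this ⊢
        exact ball_mono (by omega) this
      rcases Int.units_eq_one_or ε with rfl | rfl
      -- Here `t^r u = h t^{-q}` and `t^{-q} a = a b^{-q} = a t^{-q} v`; removing `h a t` leaves
      -- `t^{-q-1} v g`.
      · obtain ⟨q, hq⟩ : (X.t ^ r * u)⁻¹ * h ∈ Subgroup.zpowers X.t := by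
          simpa [edge, pre] using hmem
        dsimp only at hq
        have he : X.t ^ r * u * X.t ^ (-(-q)) = h := by rw [neg_neg, hq]; group
        obtain ⟨h1, h2⟩ := hf.coset hr hu (he ▸ hh)
        rw [he] at h2
        obtain ⟨v, hv, hbv⟩ := hV (-q)
        refine finish (-q - 1) (v * g) (by omega)
          (mul_mem_ball (ball_mono (hp h1) hv) hg) (ball_mono hfR h2) ?_
        have he2 : X.t ^ r * u = h * X.t ^ (-q) := by rw [← he]; group
        have hrel := X.rel_zpow (-q)
        rw [hbv] at hrel
        rw [he2] at heq
        simp only [hsyl_cons, syl_cons, map_mul, mul_assoc, mul_right_inj, Units.val_one,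
          zpow_one] at heq hrel
        rw [← mul_assoc (X.ι (X.t ^ (-q))), ← hrel] at heq
        simp only [mul_assoc, mul_right_inj] at heq
        rw [sub_eq_neg_add, zpow_add]
        simp only [map_mul, mul_assoc, heq]
        simp
      -- Here `t^r u = h t⁻¹ b^{-q}` and `b^{-q} a⁻¹ = a⁻¹ t^{-q}`, which leaves `t^{-q} g`.
      -- Bounding `h` requires rewriting `b^{-q}` as `t^{-q} v`, hence the coset bound at radius `R
      -- + p (f R)`.
      · obtain ⟨q, hq⟩ : (X.t ^ r * u)⁻¹ * (h * X.t⁻¹) ∈ Subgroup.zpowers X.b := by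
          simpa [edge, pre] using hmem
        dsimp only at hq
        have he : X.t ^ r * u * X.b ^ (-(-q)) * X.t = h := by rw [neg_neg, hq]; group
        have h1 := hf.edge hr hu (he ▸ hh)
        obtain ⟨v, hv, hbv⟩ := hV (-q)
        have hv' := ball_mono (hp h1) hv
        have he1 : X.t ^ r * (u * v⁻¹) * X.t ^ (-(-q - 1)) = h := by
          rw [← he, zpow_neg X.b (-q), hbv, mul_inv_rev, ← zpow_neg,
            show -(-q - 1) = -(-q) + 1 by ring, zpow_add_one]
          group
        have h2 := (hf.coset (n := R + p (f R)) (by omega) (mul_mem_ball hu (inv_mem_ball hv'))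
          (he1 ▸ hh)).2
        rw [he1] at h2
        refine finish (-q) g (by omega) (ball_mono (by omega) hg) h2 ?_
        have he2 : X.t ^ r * u = h * X.t⁻¹ * X.b ^ (-q) := by rw [← he]; group
        have hrel := X.rel_zpow' (-q)
        rw [he2] at heq
        simp only [hsyl_cons, syl_cons, map_mul, mul_assoc, mul_right_inj, Units.val_neg,
          Units.val_one, zpow_neg_one, mul_inv_rev, map_inv] at heq
        rw [← mul_assoc (X.ι (X.b ^ (-q))), hrel] at heq
        simpa [map_mul, mul_assoc] using heq

/-- The coset control for the extension, with the number of syllables kept separate. -/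
theorem coset_sylBall (hH : Malnormal X.t X.b (Subgroup.closure HS))
    (hf : Control X.t X.b S HS f) (hp : Monotone p)
    (hV : ∀ l : ℤ, ∃ v ∈ ball S (p l.natAbs), X.b ^ l = X.t ^ l * v)
    {m M : ℕ} {r s : ℤ} {u : E} (hr : r.natAbs ≤ M) (hu : X.SylBall S m M u)
    (h : X.ι X.t ^ r * u * X.ι X.t ^ (-s) ∈
      Subgroup.closure (insert (X.a * X.ι X.t) (X.ι '' HS))) :
    s.natAbs ≤ (stepBound f p)^[m + 1] M ∧ X.ι X.t ^ r * u * X.ι X.t ^ (-s) ∈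
      ball (insert (X.a * X.ι X.t) (X.ι '' HS)) ((stepBound f p)^[m + 1] M) := by
  obtain ⟨u₀, W, hW, rfl, hm, h0, hM⟩ := hu
  obtain ⟨h₀, hh₀, L, hL, he⟩ := exists_hsyl h
  rw [he]
  have hle : (stepBound f p)^[W.length + 1] M ≤ (stepBound f p)^[m + 1] M :=
    iterate_stepBound_mono hf.mono hp (by omega) le_rfl
  obtain ⟨h1, h2⟩ := traverse hH hf hp hV hW hM le_rfl hr h0 hh₀ hL (s := s) (by
    rw [← he]; simp [mul_assoc])
  exact ⟨h1.trans hle, ball_mono hle h2⟩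

/-! ### Negative runs -/

/-- The syllables of `a⁻¹ * (t * a⁻¹) ^ l`. -/
def negRun (t : K) : ℕ → List (ℤˣ × K)
  | 0 => [(-1, 1)]
  | l + 1 => (-1, t) :: negRun t l

theorem fst_eq_of_mem_negRun {t : K} {l : ℕ} : ∀ x ∈ negRun t l, x.1 = -1 := by
  induction l with
  | zero => simp [negRun]
  | succ l ih => simpa [negRun] using ih

theorem reduced_negRun (t b : K) (l : ℕ) : Reduced t b (negRun t l) := by
  induction l with
  | zero => exact List.isChain_singleton _
  | succ l ih =>
    exact List.isChain_cons.2
      ⟨fun y hy _ => (fst_eq_of_mem_negRun y (List.mem_of_mem_head? hy)).symm, ih⟩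

theorem length_negRun (t : K) (l : ℕ) : (negRun t l).length = l + 1 := by
  induction l with
  | zero => rfl
  | succ l ih => simp [negRun, ih]

theorem syl_negRun (l : ℕ) :
    syl X.ι X.a (negRun X.t l) = X.a⁻¹ * (X.ι X.t * X.a⁻¹) ^ l := by
  induction l with
  | zero => simp [negRun]
  | succ l ih => rw [negRun, syl_cons, ih, pow_succ']; simp [mul_assoc]

/-- An element of the subgroup followed by a negative run has at least as many syllables as the
run. -/
theorem lt_length_of_negRun (hH : Malnormal X.t X.b (Subgroup.closure HS))
    (hC : ∀ h ∈ Subgroup.closure HS, X.t * h ∉ Subgroup.zpowers X.b) {h : E}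
    (hh : h ∈ Subgroup.closure (insert (X.a * X.ι X.t) (X.ι '' HS))) {l : ℕ} {y : K}
    {Y : List (ℤˣ × K)} (hY : Reduced X.t X.b Y)
    (he : h * (X.a⁻¹ * (X.ι X.t * X.a⁻¹) ^ l) = X.ι y * syl X.ι X.a Y) : l + 1 ≤ Y.length := by
  obtain ⟨h₀, -, L, hL, rfl⟩ := exists_hsyl hh
  have hc := syl_conv (X := X) 1 (negRun X.t l) L h₀
  rw [syl_negRun, map_one, one_mul, he] at hc
  have hred := reduced_conv (b := X.b) hH (z := 1) (reduced_negRun X.t X.b l) (by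
    intro h hh ε y hy hmem
    have hy1 := fst_eq_of_mem_negRun y (List.mem_of_mem_head? hy)
    rcases Int.units_eq_one_or ε with rfl | rfl
    · exact absurd (by simpa [edge] using hmem) (hC h hh)
    · exact hy1.symm) hL
  have := congrArg List.length (X.britton hY hred hc).1
  rw [List.length_map, List.length_map, length_conv, length_negRun] at this
  omega

/-! ### From level to level -/

theorem zpow_ι_t_eq_one {n : ℤ} (h : X.ι X.t ^ n = 1) : n = 0 := by
  rw [← map_zpow, map_eq_one_iff _ X.ι_inj] at h
  exact zpow_eq_one_of_map X.τ_t (by rw [h, map_one])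

theorem negRun_eq {l : ℤ} (hl : 0 < l) :
    X.a⁻¹ * (X.ι X.t * X.a⁻¹) ^ (l.toNat - 1) = (X.ι X.t)⁻¹ * (X.ι X.t * X.a⁻¹) ^ l := by
  obtain ⟨n, rfl⟩ : ∃ n : ℕ, l = n + 1 := ⟨(l - 1).toNat, by omega⟩
  rw [show ((n : ℤ) + 1).toNat - 1 = n by omega, ← Nat.cast_succ, zpow_natCast, pow_succ']
  simp [mul_assoc]

section
variable (hH : Malnormal X.t X.b (Subgroup.closure HS))
  (hC : ∀ h ∈ Subgroup.closure HS, X.t * h ∉ Subgroup.zpowers X.b)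
include hH

theorem eq_zero_of_zpow_mem {l : ℤ}
    (hh : X.ι X.t ^ l ∈ Subgroup.closure (insert (X.a * X.ι X.t) (X.ι '' HS))) : l = 0 := by
  obtain ⟨h₀, hh₀, L, hL, he⟩ := exists_hsyl hh
  have hc := syl_conv (X := X) 1 [] L h₀
  rw [← he, syl_nil, map_one, mul_one, mul_one] at hc
  have hred := reduced_conv (b := X.b) hH (z := 1) (Y := []) List.isChain_nil (by simp) hL
  have hb := X.britton (W := []) (g := X.t ^ l) (g' := h₀ * pre X.t 1 L) List.isChain_nil
    hred (by rw [map_zpow, syl_nil, mul_one]; exact hc)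
  have hLnil : L = [] := by
    have := congrArg List.length hb.1
    rw [List.length_map, List.length_map, length_conv] at this
    exact List.length_eq_zero_iff.1 (by simpa using this.symm)
  subst hLnil
  have h1 : X.t ^ l = h₀ := X.ι_inj (by simpa using he)
  have h2 := hH.eq_one_of_mem_zpowers h₀ hh₀ ⟨l, h1⟩
  exact zpow_ι_t_eq_one (X := X) (by rw [← map_zpow, h1, h2, map_one])

include hC

/-- For `l > 0`, `t⁻¹ (t a⁻¹)^l` is a negative run with `l` stable letters, none of which cancels
against `h`; all must appear in `u`. -/
theorem le_of_edge_eq {h : E}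
    (hh : h ∈ Subgroup.closure (insert (X.a * X.ι X.t) (X.ι '' HS))) {l r : ℤ} {m M : ℕ} {u : E}
    (hu : X.SylBall S m M u)
    (he : h * ((X.ι X.t)⁻¹ * (X.ι X.t * X.a⁻¹) ^ l) = X.ι X.t ^ r * u) : l ≤ m := by
  by_contra! hl
  obtain ⟨u₀, W, hW, rfl, hm, -⟩ := hu
  rw [← negRun_eq (by omega)] at he
  have := lt_length_of_negRun hH hC hh hW (y := X.t ^ r * u₀) (by rw [he]; simp [mul_assoc])
  omega

theorem malnormal_ext : Malnormal (X.ι X.t) (X.ι X.t * X.a⁻¹)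
    (Subgroup.closure (insert (X.a * X.ι X.t) (X.ι '' HS))) := by
  refine ⟨?_, ?_⟩
  · rintro h hh ⟨l, rfl⟩
    have := eq_zero_of_zpow_mem hH hh
    simp [this]
  · have key : ∀ h ∈ Subgroup.closure (insert (X.a * X.ι X.t) (X.ι '' HS)), ∀ l : ℤ,
        (X.ι X.t * X.a⁻¹) ^ l = X.ι X.t * h * (X.ι X.t)⁻¹ → l ≤ 0 := by
      intro h hh l hl
      -- Applied with `u = 1`, which has no syllables; the case of `h⁻¹` then forces `l = 0`.
      exact le_of_edge_eq (S := ∅) hH hC (inv_mem hh) (sylBall_one (m := 0) (M := 0))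
        (r := -1) (by rw [hl]; group)
    rintro h hh ⟨l, hl⟩
    dsimp only at hl
    have h1 := key h hh l hl
    have h2 := key h⁻¹ (inv_mem hh) (-l) (by rw [zpow_neg, hl]; group)
    obtain rfl : l = 0 := by omega
    rw [zpow_zero] at hl
    have : h = (X.ι X.t)⁻¹ * (X.ι X.t * h * (X.ι X.t)⁻¹) * X.ι X.t := by group
    rw [this, ← hl]; group

variable (hyd : ∀ l : ℕ, ∃ j : ℕ, l + 1 ≤ j ∧
  (X.ι X.t)⁻¹ * (X.ι X.t * X.a⁻¹) ^ (-(l : ℤ)) * X.ι X.t ^ j ∈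
    Subgroup.closure (insert (X.a * X.ι X.t) (X.ι '' HS)))
include hyd

/-- If `t h` is the `l`-th power, then `l ≤ 0` by counting stable letters, and `hyd` puts a positive
power of `t` into the subgroup, which is impossible. -/
theorem mul_notMem_zpowers_ext :
    ∀ h ∈ Subgroup.closure (insert (X.a * X.ι X.t) (X.ι '' HS)),
      X.ι X.t * h ∉ Subgroup.zpowers (X.ι X.t * X.a⁻¹) := by
  rintro h hh ⟨l, hl⟩
  dsimp only at hl
  have h1 : l ≤ 0 := le_of_edge_eq (S := ∅) hH hC (inv_mem hh)
    (sylBall_one (m := 0) (M := 0)) (r := 0) (by rw [hl]; group)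
  obtain ⟨j, hj, hmem⟩ := hyd l.natAbs
  rw [show -(l.natAbs : ℤ) = l by omega, hl, inv_mul_cancel_left,
    Subgroup.mul_mem_cancel_left _ hh, ← zpow_natCast] at hmem
  have := eq_zero_of_zpow_mem hH hmem
  omega

theorem control_ext (hτ : ∀ x ∈ S, X.τ x = 1)
    (hf : Control X.t X.b S HS f) (hp : Monotone p)
    (hV : ∀ l : ℤ, ∃ v ∈ ball S (p l.natAbs), X.b ^ l = X.t ^ l * v) :
    Control (X.ι X.t) (X.ι X.t * X.a⁻¹) (insert X.a (X.ι '' S))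
      (insert (X.a * X.ι X.t) (X.ι '' HS)) (fun n => (stepBound f p)^[n + 1] n) where
  mono m n h := iterate_stepBound_mono hf.mono hp (by omega) h
  coset hr hu h := coset_sylBall hH hf hp hV hr (sylBall_of_mem_ball hτ hu) h
  edge := by
    intro n r l u hr hu h
    have hu' := sylBall_of_mem_ball hτ hu
    rcases le_or_gt l 0 with hl | hl
    -- Multiplying by the element from `hyd` turns the power of `t a⁻¹` into `t^j` with `j > |l|`,
    -- so the coset bound applies.
    · obtain ⟨j, hj, hmem⟩ := hyd l.natAbs
      rw [show -(l.natAbs : ℤ) = l by omega] at hmem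
      have h1 := mul_mem h hmem
      have h2 := (coset_sylBall hH hf hp hV hr hu' (s := -j) (by
        convert h1 using 1
        rw [neg_neg, zpow_natCast]
        group)).1
      omega
    · have h1 : l ≤ n := le_of_edge_eq hH hC h hu' (r := r) (l := l) (by group)
      have := le_iterate_stepBound f p (n + 1) n
      omega

end
end StableExt

/-! ### The step bound and Ackermann's functions -/

theorem IterBdd.stepBound {k : ℕ} {f p : ℕ → ℕ} (hf : IterBdd (k + 1) f)
    (hp : IterBdd (k + 1) fun n => p (f n)) : IterBdd (k + 1) (stepBound f p) := by
  have h1 := (iterBdd_id (k + 1)).add hp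
  have h2 := ((((hf.comp h1).add (iterBdd_id _)).add hp).add hf).add (iterBdd_const k 1)
  exact (h2.add h2).mono fun n => by unfold Hydra.stepBound; omega

theorem IterBdd.iterate {k : ℕ} {D : ℕ → ℕ} (hD : IterBdd (k + 1) D) :
    IterBdd (k + 2) fun n => D^[n + 1] n := by
  obtain ⟨C, hC⟩ := exists_iterate_le hD 0
  refine ⟨1 + C, fun n => ?_⟩
  have := hC n
  simp only [pow_zero, mul_one] at this
  rw [Function.iterate_add_apply, Function.iterate_one]
  exact this.trans (monotone_A _ (mul_le_iterate _ _ _))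

/-! ### Homomorphisms from hydra groups -/

theorem mk_eq_one {k : ℕ} {r : FreeGroup (Option (Fin k))} (hr : r ∈ relators k) :
    PresentedGroup.mk (relators k) r = 1 :=
  (QuotientGroup.eq_one_iff _).2 (Subgroup.subset_normalClosure hr)

theorem conj_a_zero {k : ℕ} (h : 0 < k) : (t k)⁻¹ * a ⟨0, h⟩ * t k = a ⟨0, h⟩ :=
  mul_inv_eq_one.1 (mk_eq_one (Or.inl ⟨h, rfl⟩))

theorem conj_a_succ {k i : ℕ} (h : i + 1 < k) :
    (t k)⁻¹ * a ⟨i + 1, h⟩ * t k = a ⟨i + 1, h⟩ * a ⟨i, Nat.lt_of_succ_lt h⟩ :=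
  mul_inv_eq_one.1 (mk_eq_one (Or.inr ⟨i, h, rfl⟩))

theorem exists_hom {Γ : Type*} [Group Γ] {k : ℕ} (x : Fin k → Γ) (y : Γ)
    (h0 : ∀ h : 0 < k, y⁻¹ * x ⟨0, h⟩ * y = x ⟨0, h⟩)
    (hs : ∀ (i : ℕ) (h : i + 1 < k),
      y⁻¹ * x ⟨i + 1, h⟩ * y = x ⟨i + 1, h⟩ * x ⟨i, Nat.lt_of_succ_lt h⟩) :
    ∃ f : G k →* Γ, (∀ i, f (a i) = x i) ∧ f (t k) = y := by
  refine ⟨PresentedGroup.toGroup (f := fun o => o.elim y x) ?_, fun i => ?_, ?_⟩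
  · rintro r (⟨h, rfl⟩ | ⟨i, h, rfl⟩)
    · simp [freeA, freeT, h0]
    · simp [freeA, freeT, hs]
  · exact PresentedGroup.toGroup.of _
  · exact PresentedGroup.toGroup.of _

/-- The exponent sum of `t`. -/
theorem exists_expT (k : ℕ) : ∃ τ : G k →* Multiplicative ℤ,
    (∀ i, τ (a i) = 1) ∧ τ (t k) = Multiplicative.ofAdd 1 :=
  exists_hom _ _ (by simp) (by simp)

/-- The inclusion of a hydra group into the next one. -/
theorem exists_incl (k : ℕ) : ∃ ι : G k →* G (k + 1),
    (∀ i, ι (a i) = a i.castSucc) ∧ ι (t k) = t (k + 1) :=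
  exists_hom _ _ (fun h => conj_a_zero (Nat.lt_succ_of_lt h))
    (fun _ h => conj_a_succ (Nat.lt_succ_of_lt h))

theorem exists_zpowers_equiv {K : Type*} [Group K] {t b : K} (ht : ∀ n : ℤ, t ^ n = 1 → n = 0)
    (hb : ∀ n : ℤ, b ^ n = 1 → n = 0) :
    ∃ φ : Subgroup.zpowers b ≃* Subgroup.zpowers t,
      φ ⟨b, Subgroup.mem_zpowers b⟩ = ⟨t, Subgroup.mem_zpowers t⟩ := by
  have inj : ∀ x : K, (∀ n : ℤ, x ^ n = 1 → n = 0) → Function.Injective (zpowersHom K x) := by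
    intro x hx
    rw [injective_iff_map_eq_one]
    intro n hn
    exact Multiplicative.toAdd.injective (hx _ (by simpa [zpowersHom_apply] using hn))
  let e : ∀ x : K, (∀ n : ℤ, x ^ n = 1 → n = 0) → Multiplicative ℤ ≃* Subgroup.zpowers x :=
    fun x hx => (MonoidHom.ofInjective (inj x hx)).trans
      (MulEquiv.subgroupCongr (Subgroup.range_zpowersHom x))
  have he : ∀ x hx, e x hx (Multiplicative.ofAdd 1) = ⟨x, Subgroup.mem_zpowers x⟩ := by
    intro x hx
    apply Subtype.ext
    change zpowersHom K x (Multiplicative.ofAdd 1) = x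
    simp [zpowersHom_apply]
  refine ⟨(e b hb).symm.trans (e t ht), ?_⟩
  rw [MulEquiv.trans_apply, ← he b hb, MulEquiv.symm_apply_apply, he t ht]

theorem map_syl {K E F : Type*} [Group K] [Group E] [Group F] (f : E →* F) (ι : K →* E) (a : E)
    (W : List (ℤˣ × K)) : f (syl ι a W) = syl (f.comp ι) (f a) W := by
  simp [syl, map_list_prod, Function.comp_def]

/-- Normal forms in HNN extensions descend to groups that map to the HNN extension. -/
theorem britton_of_hom {K E : Type*} [Group K] [Group E] {ι : K →* E} {t b : K} {a : E}
    {φ : Subgroup.zpowers b ≃* Subgroup.zpowers t}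
    (ψ : E →* HNNExtension K (Subgroup.zpowers b) (Subgroup.zpowers t) φ)
    (hι : ψ.comp ι = HNNExtension.of) (ha : ψ a = HNNExtension.t) {g g' : K}
    {W W' : List (ℤˣ × K)} (hW : Reduced t b W) (hW' : Reduced t b W')
    (h : ι g * syl ι a W = ι g' * syl ι a W') :
    W.map Prod.fst = W'.map Prod.fst ∧
      ∀ u ∈ W.head?.map Prod.fst, g⁻¹ * g' ∈ edge t b (-u) := by
  have h' := congrArg ψ h
  rw [map_mul, map_mul, map_syl, map_syl, hι, ha, ← MonoidHom.comp_apply, ← MonoidHom.comp_apply,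
    hι] at h'
  exact HNNExtension.ReducedWord.map_fst_eq_and_of_prod_eq φ
    (w₁ := ⟨g, W, hW⟩) (w₂ := ⟨g', W', hW'⟩) h'

/-- The element `t * a_{k+1}⁻¹` of `G (k + 1)`, which is conjugate to `t` in `G (k + 2)`. -/
def b (k : ℕ) : G (k + 1) := t (k + 1) * (a (Fin.last k))⁻¹

/-- No isomorphism with the HNN extension is needed: a homomorphism `ψ` to it that restricts to the
canonical embedding of the base pulls back both injectivity of `ι` and Britton's lemma. -/
theorem exists_stableExt (k : ℕ) : ∃ X : StableExt (G (k + 1)) (G (k + 2)),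
    X.t = t (k + 1) ∧ X.b = b k ∧ X.a = a (Fin.last (k + 1)) ∧ X.ι X.t = t (k + 2) ∧
    (∀ i, X.ι (a i) = a i.castSucc) ∧ ∀ i, X.τ (a i) = 1 := by
  obtain ⟨τ, hτa, hτt⟩ := exists_expT (k + 1)
  obtain ⟨ι, hιa, hιt⟩ := exists_incl (k + 1)
  have hτb : τ (b k) = Multiplicative.ofAdd 1 := by simp [b, hτa, hτt]
  obtain ⟨φ, hφ⟩ := exists_zpowers_equiv (t := t (k + 1)) (b := b k)
    (fun n h => zpow_eq_one_of_map hτt (by rw [h, map_one]))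
    (fun n h => zpow_eq_one_of_map hτb (by rw [h, map_one]))
  have hT := HNNExtension.t_mul_of (φ := φ) ⟨b k, Subgroup.mem_zpowers _⟩
  rw [hφ] at hT
  dsimp only at hT
  obtain ⟨ψ, hψa, hψt⟩ := exists_hom (k := k + 2)
    (Fin.lastCases (HNNExtension.t (φ := φ)) fun i => HNNExtension.of (a i))
    (HNNExtension.of (φ := φ) (t (k + 1)))
    (by
      intro _
      have h : (⟨0, by omega⟩ : Fin (k + 2)) = Fin.castSucc ⟨0, by omega⟩ := rfl
      rw [h, Fin.lastCases_castSucc, ← map_inv, ← map_mul, ← map_mul, conj_a_zero])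
    (by
      intro i hi
      have h : (⟨i, by omega⟩ : Fin (k + 2)) = Fin.castSucc ⟨i, by omega⟩ := rfl
      rw [h, Fin.lastCases_castSucc]
      by_cases hik : i = k
      · subst hik
        have h' : (⟨i + 1, by omega⟩ : Fin (i + 2)) = Fin.last (i + 1) := rfl
        rw [h', Fin.lastCases_last]
        have h'' : (⟨i, by omega⟩ : Fin (i + 1)) = Fin.last i := rfl
        rw [h'', mul_assoc, inv_mul_eq_iff_eq_mul, ← mul_assoc, ← hT, mul_assoc, ← map_mul]
        simp [b]
      · have h' : (⟨i + 1, by omega⟩ : Fin (k + 2)) = Fin.castSucc ⟨i + 1, by omega⟩ := rfl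
        rw [h', Fin.lastCases_castSucc, ← map_inv, ← map_mul, ← map_mul, ← map_mul,
          conj_a_succ])
  have hψι : ψ.comp ι = HNNExtension.of := by
    refine PresentedGroup.ext ?_
    rintro (_ | i)
    · change ψ (ι (t (k + 1))) = _
      rw [hιt, hψt]; rfl
    · change ψ (ι (a i)) = _
      rw [hιa, hψa, Fin.lastCases_castSucc]; rfl
  have hlast : ψ (a (Fin.last (k + 1))) = HNNExtension.t := by rw [hψa, Fin.lastCases_last]
  refine ⟨{ ι := ι, t := t (k + 1), b := b k, a := a (Fin.last (k + 1)), τ := τ,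
            ι_inj := ?_, τ_t := hτt, τ_b := hτb, rel := ?_,
            britton := britton_of_hom ψ hψι hlast },
    rfl, rfl, rfl, hιt, hιa, hτa⟩
  · have : Function.Injective (ψ.comp ι) := by
      rw [hψι]; exact HNNExtension.of_injective φ
    exact Function.Injective.of_comp (f := ψ) (by simpa using this)
  · have := conj_a_succ (k := k + 2) (i := k) (by omega)
    rw [mul_assoc, inv_mul_eq_iff_eq_mul, ← mul_assoc] at this
    rw [b, map_mul, map_inv, hιt, hιa, ← mul_assoc, mul_inv_eq_iff_eq_mul]
    exact this

/-! ### Conjugates of the generators by powers of `t` -/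

/-- The generators `a_1, …, a_i` of `G k`. -/
def lowGens (k i : ℕ) : Set (G k) := {x | ∃ j : Fin k, j.val < i ∧ a j = x}

/-- Raising `l` by one appends the conjugate `t^{-l} a_i t^l` of the previous generator, so the
degree grows by one with the index. The `n + 1` counts the leading generator too. -/
theorem conj_zpow_a (k i : ℕ) (h : i < k) (l : ℤ) : ∃ n, ∃ v ∈ ball (lowGens k i) n,
    n + 1 ≤ (l.natAbs + 1) ^ i ∧ t k ^ (-l) * a ⟨i, h⟩ * t k ^ l = a ⟨i, h⟩ * v := by
  induction i generalizing l with
  | zero =>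
    have hc : Commute (a ⟨0, h⟩) (t k) := by
      have := conj_a_zero h
      rw [mul_assoc, inv_mul_eq_iff_eq_mul] at this
      exact this
    refine ⟨0, 1, one_mem_ball, by simp, ?_⟩
    rw [mul_assoc, (hc.zpow_right l).eq]; group
  | succ i ih =>
    have ih := ih (Nat.lt_of_succ_lt h)
    have hlow : lowGens k i ⊆ lowGens k (i + 1) := fun x ⟨j, hj, hx⟩ => ⟨j, by omega, hx⟩
    have hball : ∀ l : ℤ, t k ^ (-l) * a ⟨i, Nat.lt_of_succ_lt h⟩ * t k ^ l ∈
        ball (lowGens k (i + 1)) ((l.natAbs + 1) ^ i) := by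
      intro l
      obtain ⟨n, v, hv, hn, he⟩ := ih l
      rw [he]
      exact ball_mono (by omega) (mul_mem_ball (mem_ball_one ⟨_, Nat.lt_succ_self i, rfl⟩)
        (ball_subset_ball hlow hv))
    have hrel := conj_a_succ h
    induction l using Int.induction_on with
    | zero => exact ⟨0, 1, one_mem_ball, by simp, by simp⟩
    | succ l ihl =>
      obtain ⟨n, v, hv, hn, he⟩ := ihl
      refine ⟨_, _, mul_mem_ball hv (hball l), ?_, ?_⟩
      · have h1 : ((l : ℤ) + 1).natAbs = l + 1 := by omega
        have h2 : (l : ℤ).natAbs = l := by omega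
        rw [h1]; rw [h2] at hn ⊢
        have h3 : (l + 1) ^ i ≤ (l + 1 + 1) ^ i := Nat.pow_le_pow_left (by omega) _
        rw [pow_succ] at hn ⊢
        nlinarith
      · rw [← mul_assoc, ← he]
        calc _ = t k ^ (-(l : ℤ)) * ((t k)⁻¹ * a ⟨i + 1, h⟩ * t k) * t k ^ (l : ℤ) := by group
          _ = _ := by rw [hrel]; group
    | pred l ihl =>
      obtain ⟨n, v, hv, hn, he⟩ := ihl
      refine ⟨_, _, mul_mem_ball hv (inv_mem_ball (hball (-(l : ℤ) - 1))), ?_, ?_⟩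
      · have h1 : (-(l : ℤ) - 1).natAbs = l + 1 := by omega
        have h2 : (-(l : ℤ)).natAbs = l := by omega
        rw [h1]; rw [h2] at hn
        have h3 : (l + 1) ^ i ≤ (l + 1 + 1) ^ i := Nat.pow_le_pow_left (by omega) _
        rw [pow_succ] at hn ⊢
        nlinarith
      · rw [← mul_assoc, ← he]
        have hrel' : a ⟨i + 1, h⟩ = ((t k)⁻¹ * a ⟨i + 1, h⟩ * t k) *
            (a ⟨i, Nat.lt_of_succ_lt h⟩)⁻¹ := by rw [hrel]; group
        conv_lhs => rw [hrel']
        group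

/-! ### The negative exponents -/

/-- The hydra battle: `t^{-(n+1)} a_{i+1} = t^{-n} a_{i+1} a_i t⁻¹`. The head `a_{i+1}` is absorbed
at the cost of `t^{-j}`, which then meets `a_i`. Only existence of `j` and `j > n` are used, not its
size. -/
theorem zpow_mul_a_mem (k i : ℕ) (h : i < k) (n : ℕ) :
    ∃ j : ℕ, n + 1 ≤ j ∧ t k ^ (-(n : ℤ)) * a ⟨i, h⟩ * t k ^ j ∈ H k := by
  have hgen : ∀ i : Fin k, a i * t k ∈ H k := fun i => Subgroup.subset_closure ⟨i, rfl⟩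
  induction i generalizing n with
  | zero =>
    refine ⟨n + 1, le_rfl, ?_⟩
    have hc : Commute (a ⟨0, h⟩) (t k) := by
      have := conj_a_zero h
      rw [mul_assoc, inv_mul_eq_iff_eq_mul] at this
      exact this
    convert hgen ⟨0, h⟩ using 1
    rw [mul_assoc, (hc.pow_right _).eq, pow_succ, ← zpow_natCast, mul_assoc, ← mul_assoc,
      ← zpow_add, neg_add_cancel, zpow_zero, one_mul, hc.eq]
  | succ i ih =>
    have ih := ih (Nat.lt_of_succ_lt h)
    induction n with
    | zero => exact ⟨1, le_rfl, by simpa using hgen ⟨i + 1, h⟩⟩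
    | succ n ihn =>
      obtain ⟨j, hj, h1⟩ := ihn
      obtain ⟨j', hj', h2⟩ := ih j
      refine ⟨j' + 1, by omega, ?_⟩
      convert mul_mem h1 h2 using 1
      calc _ = t k ^ (-(n : ℤ)) * ((t k)⁻¹ * a ⟨i + 1, h⟩ * t k) * t k ^ j' := by
            rw [pow_succ', Nat.cast_succ, neg_add, zpow_add, zpow_neg_one]
            simp only [mul_assoc]
        _ = _ := by
            rw [conj_a_succ h, zpow_neg (t k) (j : ℤ), zpow_natCast]
            simp only [mul_assoc, mul_inv_cancel_left]

theorem inv_mul_zpow_mem (k l : ℕ) : ∃ j : ℕ, l + 1 ≤ j ∧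
    (t (k + 1))⁻¹ * b k ^ (-(l : ℤ)) * t (k + 1) ^ j ∈ H (k + 1) := by
  induction l with
  | zero => exact ⟨1, le_rfl, by simp⟩
  | succ l ih =>
    obtain ⟨j, hj, h1⟩ := ih
    obtain ⟨j', hj', h2⟩ := zpow_mul_a_mem (k + 1) k (Nat.lt_succ_self k) j
    refine ⟨j' + 1, by omega, ?_⟩
    convert mul_mem h1 h2 using 1
    have hb : (b k)⁻¹ = a (Fin.last k) * (t (k + 1))⁻¹ := by simp [b]
    change _ = _ * (_ * a (Fin.last k) * _)
    rw [Nat.cast_succ, neg_add, zpow_add, zpow_neg_one, hb, zpow_neg (t (k + 1)) (j : ℤ),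
      zpow_natCast, pow_succ']
    simp only [mul_assoc, mul_inv_cancel_left, inv_mul_cancel_left]

/-! ### The induction on the rank -/

/-- The generators of `H k`. -/
def hGens (k : ℕ) : Set (G k) := Set.range fun i : Fin k => a i * t k

theorem range_a_succ {k : ℕ} {ι : G k →* G (k + 1)} (hι : ∀ i, ι (a i) = a i.castSucc) :
    Set.range (a (k := k + 1)) = insert (a (Fin.last k)) (ι '' Set.range a) := by
  ext x
  simp only [Set.mem_range, Set.mem_insert_iff, Set.mem_image, exists_exists_eq_and, hι,
    Fin.exists_fin_succ']
  tauto

theorem hGens_succ {k : ℕ} {ι : G k →* G (k + 1)} (hι : ∀ i, ι (a i) = a i.castSucc)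
    (hιt : ι (t k) = t (k + 1)) :
    hGens (k + 1) = insert (a (Fin.last k) * ι (t k)) (ι '' hGens k) := by
  ext x
  simp only [hGens, Set.mem_range, Set.mem_insert_iff, Set.mem_image, exists_exists_eq_and,
    map_mul, hι, hιt, Fin.exists_fin_succ']
  tauto

theorem lowGens_eq_image {k : ℕ} {ι : G k →* G (k + 1)} (hι : ∀ i, ι (a i) = a i.castSucc) :
    lowGens (k + 1) k = ι '' Set.range a := by
  ext x
  simp [lowGens, hι, Fin.exists_fin_succ']

/-- As `b^l = a⁻¹ t^l a`, the inverse of the error term in `t^{-l} a t^l = a v` is the required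
word; it lies in the base because it uses lower generators only. -/
theorem exists_b_zpow {k : ℕ} {X : StableExt (G (k + 1)) (G (k + 2))}
    (ha : X.a = a (Fin.last (k + 1))) (ht : X.ι X.t = t (k + 2))
    (hι : ∀ i, X.ι (a i) = a i.castSucc) (l : ℤ) :
    ∃ v ∈ ball (Set.range a) ((l.natAbs + 1) ^ (k + 1)), X.b ^ l = X.t ^ l * v := by
  obtain ⟨n, v, hv, hn, he⟩ := conj_zpow_a (k + 2) (k + 1) (Nat.lt_succ_self _) l
  rw [lowGens_eq_image hι] at hv
  obtain ⟨w, hw, rfl⟩ := exists_map_eq_of_mem_ball_image _ hv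
  refine ⟨w⁻¹, inv_mem_ball (ball_mono (by omega) hw), X.ι_inj ?_⟩
  change _ * a (Fin.last (k + 1)) * _ = a (Fin.last (k + 1)) * _ at he
  rw [← ha, ← ht] at he
  have h1 : X.ι (X.b ^ l) = X.a⁻¹ * (X.ι X.t ^ l * X.a) := by
    rw [eq_inv_mul_iff_mul_eq, X.rel_zpow, map_zpow]
  have h2 : X.ι w = X.a⁻¹ * (X.ι X.t ^ (-l) * X.a * X.ι X.t ^ l) := by
    rw [he, inv_mul_cancel_left]
  rw [h1, map_mul, map_inv, map_zpow, h2]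
  group

theorem mem_closure_singleton_one {h : G 1} (hh : h ∈ H 1) (hc : Commute (a 0) (t 1)) :
    ∃ p : ℤ, h = a 0 ^ p * t 1 ^ p := by
  have h1 : Set.range (fun i : Fin 1 => a i * t 1) = {a 0 * t 1} := by
    ext x; simp [eq_comm]
  rw [H, h1, Subgroup.mem_closure_singleton] at hh
  obtain ⟨p, rfl⟩ := hh
  exact ⟨p, hc.mul_zpow p⟩

theorem commute_a_t_one : Commute (a 0) (t 1) := by
  have := conj_a_zero (k := 1) one_pos
  rw [mul_assoc, inv_mul_eq_iff_eq_mul] at this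
  exact this

theorem exists_zpow_of_mem_ball {n : ℕ} {u : G 1} (hu : u ∈ ball (Set.range a) n) :
    ∃ m : ℤ, m.natAbs ≤ n ∧ u = a 0 ^ m := by
  refine ball_induction (p := fun n u => ∃ m : ℤ, m.natAbs ≤ n ∧ u = a 0 ^ m)
    ⟨0, by simp, by simp⟩ ?_ ?_ ?_ hu
  · rintro n _ _ ⟨i, rfl⟩ ⟨m, hm, rfl⟩
    obtain rfl := Subsingleton.elim i 0
    exact ⟨1 + m, by omega, by rw [zpow_one_add]⟩
  · rintro n _ _ ⟨i, rfl⟩ ⟨m, hm, rfl⟩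
    obtain rfl := Subsingleton.elim i 0
    exact ⟨-1 + m, by omega, by rw [zpow_add, zpow_neg_one]⟩
  · rintro m n _ h ⟨q, hq, rfl⟩
    exact ⟨q, by omega, rfl⟩

theorem eq_of_mul_eq {r s r' s' : ℤ} (h : a 0 ^ r * t 1 ^ s = a 0 ^ r' * t 1 ^ s') :
    r = r' ∧ s = s' := by
  obtain ⟨τ, hτa, hτt⟩ := exists_expT 1
  obtain ⟨α, hαa, hαt⟩ := exists_hom (k := 1) (fun _ => Multiplicative.ofAdd (1 : ℤ)) 1
    (by simp) (by simp)
  have h1 := congrArg τ h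
  have h2 := congrArg α h
  simp only [map_mul, map_zpow, hτa, hτt, hαa, hαt, one_zpow, one_mul, mul_one, ← ofAdd_zsmul,
    smul_eq_mul, EmbeddingLike.apply_eq_iff_eq] at h1 h2
  exact ⟨h2, h1⟩

theorem b_zero_zpow (l : ℤ) : b 0 ^ l = a 0 ^ (-l) * t 1 ^ l := by
  have hc := commute_a_t_one
  change (t 1 * (a 0)⁻¹) ^ l = _
  rw [hc.symm.inv_right.mul_zpow, inv_zpow', (hc.symm.zpow_zpow _ _).eq]

/-- `G 1` is abelian with independent exponents of `a` and `t`, and `H 1` is the diagonal, so each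
claim is linear arithmetic. -/
theorem exists_level_one : ∃ f, IterBdd 1 f ∧ (∀ n, f n = 2 * n + 2) ∧
    Control (t 1) (b 0) (Set.range a) (hGens 1) f ∧
    StableExt.Malnormal (t 1) (b 0) (H 1) ∧
    ∀ h ∈ H 1, t 1 * h ∉ Subgroup.zpowers (b 0) := by
  have hc := commute_a_t_one
  refine ⟨fun n => 2 * n + 2, ?_, fun _ => rfl, ⟨?_, ?_, ?_⟩, ⟨?_, ?_⟩, ?_⟩
  · exact (((iterBdd_id 1).add (iterBdd_id 1)).add (iterBdd_const 0 2)).mono fun n => by omega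
  · intro m n h; dsimp only; omega
  · intro n r s u hr hu h
    obtain ⟨m, hm, rfl⟩ := exists_zpow_of_mem_ball hu
    have he : t 1 ^ r * a 0 ^ m * t 1 ^ (-s) = a 0 ^ m * t 1 ^ (r - s) := by
      rw [← (hc.zpow_zpow m r).eq, mul_assoc, ← zpow_add, sub_eq_add_neg]
    rw [he] at h ⊢
    obtain ⟨p, hp⟩ := mem_closure_singleton_one h hc
    obtain ⟨h1, h2⟩ := eq_of_mul_eq hp
    refine ⟨by omega, ?_⟩
    rw [hp, ← hc.mul_zpow]
    exact ball_mono (m := p.natAbs) (by omega) (zpow_mem_ball (Set.mem_range_self 0) p)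
  · intro n r l u hr hu h
    obtain ⟨m, hm, rfl⟩ := exists_zpow_of_mem_ball hu
    have he : t 1 ^ r * a 0 ^ m * b 0 ^ (-l) * t 1 = a 0 ^ (m + l) * t 1 ^ (r - l + 1) := by
      rw [b_zero_zpow, ← (hc.zpow_zpow m r).eq, neg_neg, mul_assoc (a 0 ^ m),
        ← mul_assoc (t 1 ^ r), ← (hc.zpow_zpow l r).eq, zpow_add, zpow_add, zpow_sub, zpow_one,
        zpow_neg]
      simp only [mul_assoc]
    rw [he] at h
    obtain ⟨p, hp⟩ := mem_closure_singleton_one h hc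
    obtain ⟨h1, h2⟩ := eq_of_mul_eq hp
    omega
  · rintro h hh ⟨l, rfl⟩
    obtain ⟨p, hp⟩ := mem_closure_singleton_one hh hc
    obtain ⟨h1, h2⟩ := eq_of_mul_eq (r := 0) (s := l) (by simpa using hp)
    obtain rfl : l = 0 := by omega
    simp
  · rintro h hh ⟨l, hl⟩
    obtain ⟨p, rfl⟩ := mem_closure_singleton_one hh hc
    dsimp only at hl
    have he : t 1 * (a 0 ^ p * t 1 ^ p) * (t 1)⁻¹ = a 0 ^ p * t 1 ^ p := by
      rw [← mul_assoc, ← (hc.zpow_left p).eq]; group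
    rw [b_zero_zpow, he] at hl
    obtain ⟨h1, h2⟩ := eq_of_mul_eq hl
    obtain rfl : p = 0 := by omega
    simp
  -- Parity: comparing exponents gives `p = -l` and `1 + p = l`, so `2 * l = 1`.
  · rintro h hh ⟨l, hl⟩
    obtain ⟨p, rfl⟩ := mem_closure_singleton_one hh hc
    dsimp only at hl
    rw [b_zero_zpow, ← mul_assoc, ← (hc.zpow_left p).eq, mul_assoc, ← zpow_one_add] at hl
    obtain ⟨h1, h2⟩ := eq_of_mul_eq hl
    omega

/-- The degree is tied to the level: level one has no room for powers, but there the exponent is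
`1`. -/
theorem iterBdd_add_one_pow {k : ℕ} {f : ℕ → ℕ} (hf : IterBdd (k + 1) f) :
    IterBdd (k + 1) fun n => (f n + 1) ^ (k + 1) := by
  cases k with
  | zero => exact (hf.add (iterBdd_const 0 1)).mono fun n => by simp
  | succ k => exact hf.add_one_pow

theorem monotone_add_one_pow (c : ℕ) : Monotone fun n : ℕ => (n + 1) ^ c :=
  fun m n h => Nat.pow_le_pow_left (by omega) _

/-- The control of `H k` by level `k` of Ackermann's hierarchy. -/
theorem exists_level (k : ℕ) : ∃ f, IterBdd (k + 1) f ∧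
    Control (t (k + 1)) (b k) (Set.range a) (hGens (k + 1)) f ∧
    StableExt.Malnormal (t (k + 1)) (b k) (H (k + 1)) ∧
    ∀ h ∈ H (k + 1), t (k + 1) * h ∉ Subgroup.zpowers (b k) := by
  induction k with
  | zero =>
    obtain ⟨f, hfA, -, h⟩ := exists_level_one
    exact ⟨f, hfA, h⟩
  | succ k ih =>
    obtain ⟨f, hfA, hf, hM, hC⟩ := ih
    obtain ⟨X, hXt, hXb, hXa, hXιt, hXι, hXτ⟩ := exists_stableExt k
    have hV := exists_b_zpow hXa hXιt hXι
    have hb : b (k + 1) = X.ι X.t * X.a⁻¹ := by rw [hXιt, hXa]; rfl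
    have hgens : Set.range (a (k := k + 2)) = insert X.a (X.ι '' Set.range a) := by
      rw [hXa]; exact range_a_succ hXι
    have hhgens : hGens (k + 2) = insert (X.a * X.ι X.t) (X.ι '' hGens (k + 1)) := by
      rw [hXa, hXt]; exact hGens_succ hXι (by rw [← hXt, hXιt])
    have hH : H (k + 2) = Subgroup.closure (insert (X.a * X.ι X.t) (X.ι '' hGens (k + 1))) := by
      rw [← hhgens]; rfl
    have hyd := inv_mul_zpow_mem (k + 1)
    rw [← hXt, ← hXb] at hf hM hC
    simp only [hb] at hyd
    rw [← hXιt, hH] at hyd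
    have hτ : ∀ x ∈ Set.range a, X.τ x = 1 := by rintro _ ⟨i, rfl⟩; exact hXτ i
    refine ⟨_, (hfA.stepBound (p := fun n => (n + 1) ^ (k + 1))
      (iterBdd_add_one_pow hfA)).iterate, ?_, ?_, ?_⟩
    · rw [hb, hgens, hhgens, ← hXιt]
      exact StableExt.control_ext hM hC hyd hτ hf (monotone_add_one_pow _) hV
    · rw [hb, hH, ← hXιt]
      exact StableExt.malnormal_ext hM hC
    · rw [hb, hH, ← hXιt]
      exact StableExt.mul_notMem_zpowers_ext hM hC hyd

/-! ### Words on all generators -/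

/-- Each `a_i` passed by `t^r` becomes a conjugate of polynomial length containing at most one
stable letter. The bound `N` is fixed so that all conjugates share one length bound during the
induction. -/
theorem exists_sylBall {k : ℕ} {X : StableExt (G (k + 1)) (G (k + 2))}
    (ha : X.a = a (Fin.last (k + 1))) (ht : X.ι X.t = t (k + 2))
    (hι : ∀ i, X.ι (a i) = a i.castSucc) (hτ : ∀ x ∈ Set.range a, X.τ x = 1) (N : ℕ) {n : ℕ}
    {g : G (k + 2)} (hg : g ∈ ball (insert (t (k + 2)) (Set.range a)) n) (hn : n ≤ N) :
    ∃ (r : ℤ) (u : G (k + 2)), r.natAbs ≤ n ∧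
      X.SylBall (Set.range a) n (n * (N + 1) ^ (k + 1)) u ∧ g = X.ι X.t ^ r * u := by
  set P := (N + 1) ^ (k + 1) with hP
  have letter : ∀ (i : Fin (k + 2)) (r : ℤ), r.natAbs ≤ N → ∀ (n : ℕ) (u : G (k + 2)),
      X.SylBall (Set.range a) n (n * P) u →
      X.SylBall (Set.range a) (n + 1) ((n + 1) * P)
        (X.ι X.t ^ (-r) * a i * X.ι X.t ^ r * u) ∧
      X.SylBall (Set.range a) (n + 1) ((n + 1) * P)
        ((X.ι X.t ^ (-r) * a i * X.ι X.t ^ r)⁻¹ * u) := by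
    intro i r hr n u hu
    have hrP : ∀ j ≤ k + 1, (r.natAbs + 1) ^ j ≤ P := fun j hj =>
      (Nat.pow_le_pow_left (by omega) _).trans (Nat.pow_le_pow_right (by omega) hj)
    obtain ⟨c, v, hv, hc, he⟩ := conj_zpow_a (k + 2) i i.isLt r
    have hcP := hc.trans (hrP i (by omega))
    rw [Fin.eta, ← ht] at he
    rw [he]
    have hlow : lowGens (k + 2) i ⊆ lowGens (k + 2) (k + 1) := fun x ⟨j, hj, hx⟩ =>
      ⟨j, by omega, hx⟩
    have hv' := ball_subset_ball hlow hv
    have hnP : n * P + P = (n + 1) * P := by ring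
    by_cases hi : i = Fin.last (k + 1)
    · rw [lowGens_eq_image hι] at hv'
      obtain ⟨w, hw, rfl⟩ := exists_map_eq_of_mem_ball_image _ hv'
      rw [hi, ← ha]
      constructor
      · simpa [mul_assoc] using ((hu.base_mul hw).zpow_mul hτ 1).mono (N := (n + 1) * P) le_rfl
          (by omega)
      · simpa [mul_assoc] using ((hu.zpow_mul hτ (-1)).base_mul (inv_mem_ball hw)).mono
          (N := (n + 1) * P) le_rfl (by omega)
    · have hi' : i.val < k + 1 := by
        have := Fin.val_lt_last hi
        exact this
      have hmem := mul_mem_ball (mem_ball_one (S := lowGens (k + 2) (k + 1)) ⟨i, hi', rfl⟩) hv'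
      rw [lowGens_eq_image hι] at hmem
      obtain ⟨w, hw, he⟩ := exists_map_eq_of_mem_ball_image _ hmem
      rw [← he, ← map_inv]
      exact ⟨(hu.base_mul hw).mono (by omega) (by omega),
        (hu.base_mul (inv_mem_ball hw)).mono (by omega) (by omega)⟩
  refine ball_induction (p := fun n g => n ≤ N → ∃ (r : ℤ) (u : G (k + 2)), r.natAbs ≤ n ∧
      X.SylBall (Set.range a) n (n * P) u ∧ g = X.ι X.t ^ r * u) ?_ ?_ ?_ ?_ hg hn
  · exact fun _ => ⟨0, 1, by simp, StableExt.sylBall_one, by simp⟩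
  · rintro n x g hx ih hn
    obtain ⟨r, u, hr, hu, rfl⟩ := ih (by omega)
    rcases hx with rfl | ⟨i, rfl⟩
    · refine ⟨1 + r, u, ?_, hu.mono (by omega) (Nat.mul_le_mul_right _ (by omega)),
        by rw [zpow_one_add, ht, mul_assoc]⟩
      exact (Int.natAbs_add_le 1 r).trans (by rw [add_comm]; exact Nat.add_le_add_right hr 1)
    · exact ⟨r, _, by omega, (letter i r (by omega) n u hu).1, by group⟩
  · rintro n x g hx ih hn
    obtain ⟨r, u, hr, hu, rfl⟩ := ih (by omega)
    rcases hx with rfl | ⟨i, rfl⟩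
    · refine ⟨-1 + r, u, ?_, hu.mono (by omega) (Nat.mul_le_mul_right _ (by omega)),
        by rw [zpow_add, zpow_neg_one, ht, mul_assoc]⟩
      exact (Int.natAbs_add_le (-1) r).trans (by rw [add_comm]; exact Nat.add_le_add_right hr 1)
    · exact ⟨r, _, by omega, (letter i r (by omega) n u hu).2, by group⟩
  · rintro m n g hmn ih hn
    obtain ⟨r, u, hr, hu, he⟩ := ih (by omega)
    exact ⟨r, u, by omega, hu.mono hmn (Nat.mul_le_mul_right _ hmn), he⟩

theorem exists_eq_zpow_mul_zpow {n : ℕ} {g : G 1}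
    (hg : g ∈ ball (insert (t 1) (Set.range a)) n) :
    ∃ r m : ℤ, r.natAbs ≤ n ∧ m.natAbs ≤ n ∧ g = t 1 ^ r * a 0 ^ m := by
  have hc := commute_a_t_one
  refine ball_induction (p := fun n g => ∃ r m : ℤ, r.natAbs ≤ n ∧ m.natAbs ≤ n ∧
    g = t 1 ^ r * a 0 ^ m) ⟨0, 0, by simp, by simp, by simp⟩ ?_ ?_ ?_ hg
  · rintro n x _ hx ⟨r, m, hr, hm, rfl⟩
    rcases hx with rfl | ⟨i, rfl⟩
    · exact ⟨1 + r, m, by omega, by omega, by rw [zpow_one_add, mul_assoc]⟩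
    · obtain rfl := Subsingleton.elim i 0
      exact ⟨r, 1 + m, by omega, by omega, by
        rw [zpow_one_add, ← mul_assoc, ← mul_assoc, (hc.zpow_right r).eq]⟩
  · rintro n x _ hx ⟨r, m, hr, hm, rfl⟩
    rcases hx with rfl | ⟨i, rfl⟩
    · exact ⟨-1 + r, m, by omega, by omega, by rw [zpow_add, zpow_neg_one, mul_assoc]⟩
    · obtain rfl := Subsingleton.elim i 0
      exact ⟨r, -1 + m, by omega, by omega, by
        rw [zpow_add, zpow_neg_one, ← mul_assoc, ← mul_assoc, (hc.zpow_right r).inv_left.eq]⟩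
  · rintro m n g hmn ⟨r, q, hr, hq, he⟩
    exact ⟨r, q, by omega, by omega, he⟩

/-- Elements of `H k` which are short in `G k` have length bounded by level `k` of Ackermann's
hierarchy. -/
theorem exists_bound (k : ℕ) : ∃ C, ∀ n, ∀ h ∈ H (k + 1),
    h ∈ ball (insert (t (k + 1)) (Set.range a)) n →
    h ∈ ball (hGens (k + 1)) (A (k + 1) (C * (n + 1))) := by
  cases k with
  | zero =>
    obtain ⟨f, -, hf2, hf, -⟩ := exists_level_one
    refine ⟨1, fun n h hh hn => ?_⟩
    obtain ⟨r, m, hr, hm, rfl⟩ := exists_eq_zpow_mul_zpow hn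
    have hu : a (k := 1) 0 ^ m ∈ ball (Set.range a) n :=
      ball_mono hm (zpow_mem_ball (Set.mem_range_self 0) m)
    have := (hf.coset (s := 0) hr hu (by rwa [neg_zero, zpow_zero, mul_one])).2
    rw [hf2, neg_zero, zpow_zero, mul_one] at this
    refine ball_mono ?_ this
    rw [A_one]; omega
  | succ k =>
    obtain ⟨f, hfA, hf, hM, hC⟩ := exists_level k
    obtain ⟨X, hXt, hXb, hXa, hXιt, hXι, hXτ⟩ := exists_stableExt k
    have hV := exists_b_zpow hXa hXιt hXι
    have hhgens : hGens (k + 2) = insert (X.a * X.ι X.t) (X.ι '' hGens (k + 1)) := by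
      rw [hXa, hXt]; exact hGens_succ hXι (by rw [← hXt, hXιt])
    rw [← hXt, ← hXb] at hf hM
    have hτ : ∀ x ∈ Set.range a, X.τ x = 1 := by rintro _ ⟨i, rfl⟩; exact hXτ i
    obtain ⟨C, hCn⟩ := exists_iterate_le (hfA.stepBound (p := fun n => (n + 1) ^ (k + 1))
      (iterBdd_add_one_pow hfA)) (k + 1)
    refine ⟨C, fun n h hh hn => ?_⟩
    obtain ⟨r, u, hr, hu, rfl⟩ := exists_sylBall hXa hXιt hXι hτ n hn le_rfl
    have hr' : r.natAbs ≤ n * (n + 1) ^ (k + 1) :=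
      hr.trans (Nat.le_mul_of_pos_right _ (by positivity))
    change _ ∈ Subgroup.closure (hGens (k + 2)) at hh
    rw [hhgens] at hh ⊢
    -- The iteration count is governed by the `n` syllables, not by the polynomial radius.
    have := (StableExt.coset_sylBall hM hf (monotone_add_one_pow _) hV (s := 0) hr' hu
      (by rwa [neg_zero, zpow_zero, mul_one])).2
    rw [neg_zero, zpow_zero, mul_one] at this
    exact ball_mono (Nat.le_of_succ_le (hCn n)) this

theorem closure_insert_t_range_a (k : ℕ) :
    Subgroup.closure (insert (t k) (Set.range (a (k := k)))) = ⊤ := by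
  rw [← top_le_iff, ← PresentedGroup.closure_range_of, Subgroup.closure_le]
  rintro _ ⟨_ | i, rfl⟩
  · exact Subgroup.subset_closure (Set.mem_insert _ _)
  · exact Subgroup.subset_closure (Set.mem_insert_of_mem _ ⟨i, rfl⟩)

end Hydra

/-! ### Change of generating sets -/

theorem corollary8p2 (k : ℕ) (hk : 1 ≤ k)
    (S : Set (Hydra.G k)) (hSfin : S.Finite) (hSgen : Subgroup.closure S = ⊤)
    (T : Set (Hydra.H k)) (hTfin : T.Finite) (hTgen : Subgroup.closure T = ⊤) :
    Hydra.Preceq (Hydra.distortion (Hydra.H k) S T) (Hydra.A k) := by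
  obtain ⟨k, rfl⟩ : ∃ j, k = j + 1 := ⟨k - 1, by omega⟩
  obtain ⟨C, hC⟩ := Hydra.exists_bound k
  obtain ⟨c, hc⟩ := Hydra.exists_subset_ball (Hydra.closure_insert_t_range_a (k + 1)) hSfin
  obtain ⟨c', hc'⟩ := Hydra.exists_subset_ball hTgen
    (F := (Subtype.val : Hydra.H (k + 1) → Hydra.G (k + 1)) ⁻¹' Hydra.hGens (k + 1))
    ((Set.finite_range _).preimage Subtype.val_injective.injOn)
  -- `c` rescales the input length from `S` to the standard generators, `c'` the output length from
  -- `hGens` to `T`.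
  refine ⟨(C + 1) * (c + 1) * (c' + 1), by positivity, fun n => ?_⟩
  obtain ⟨h, hn, hd⟩ := (Hydra.isGreatest_distortion (Hydra.H (k + 1)) hSfin hSgen T n).1
  rw [← hd]
  have h1 := Hydra.ball_mono hn (Hydra.mem_ball_wordNorm hSgen (h : Hydra.G (k + 1)))
  have h2 := hC _ _ h.2 (Hydra.mem_ball_of_subset_ball hc h1)
  have himage : (Hydra.H (k + 1)).subtype ''
      ((Subtype.val : Hydra.H (k + 1) → Hydra.G (k + 1)) ⁻¹' Hydra.hGens (k + 1)) =
        Hydra.hGens (k + 1) := by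
    refine (Set.image_preimage_eq_of_subset fun x hx => ?_)
    exact ⟨⟨x, Subgroup.subset_closure hx⟩, rfl⟩
  rw [← himage] at h2
  obtain ⟨g, hg, hgh⟩ := Hydra.exists_map_eq_of_mem_ball_image _ h2
  obtain rfl : g = h := Subtype.ext hgh
  have h3 := Hydra.wordNorm_le_of_mem_ball (Hydra.mem_ball_of_subset_ball hc' hg)
  set K := (C + 1) * (c + 1) * (c' + 1) with hK
  have hCc : C * c ≤ K := by
    rw [hK]
    calc C * c ≤ (C + 1) * (c + 1) * 1 := by nlinarith
      _ ≤ _ := Nat.mul_le_mul_left _ (by omega)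
  have hCK : C ≤ K := by
    rw [hK]
    calc C ≤ (C + 1) * (c + 1) * 1 := by nlinarith
      _ ≤ _ := Nat.mul_le_mul_left _ (by omega)
  have hcK : c' ≤ K := by
    rw [hK]
    calc c' ≤ 1 * (c' + 1) := by omega
      _ ≤ _ := Nat.mul_le_mul_right _ (Nat.one_le_iff_ne_zero.2 (by positivity))
  have h4 : Hydra.A (k + 1) (C * (n * c + 1)) ≤ Hydra.A (k + 1) (K * n + K) := by
    refine Hydra.monotone_A k ?_
    nlinarith [Nat.mul_le_mul_right n hCc]
  calc _ ≤ _ := h3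
    _ ≤ Hydra.A (k + 1) (K * n + K) * K := Nat.mul_le_mul h4 hcK
    _ ≤ _ := by rw [mul_comm]; omega
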